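/- Let $(X,d)$ be a locally compact separable metric space with its Borel $\sigma$-field, and let $\mu$ be a Radon measure on $X$; all functions are real-valued. Let $(T(t))_{t\ge 0}$ be a strongly continuous symmetric semigroup on $L_2(\mu)$ which is Markovian ($0\le u\le 1$ $\mu$-a.e. implies $0\le T(t)u\le 1$ $\mu$-a.e.). For $1\le p<\infty$ denote by the same symbol the semigroup on $L_p(\mu)$ given by the bounded extension of $T(t)|_{L_2(\mu)\cap L_p(\mu)}$, and let $-A_p$ be its generator, $A=A_2$. For $0<\alpha<1$ let $$A_p^{\alpha}u=\lim_{\varepsilon\to0}\frac1{\Gamma(-\alpha)}\int_\varepsilon^\infty t^{-\alpha-1}(T(t)-I)u\,dt \quad\text{in } L_p(\mu),$$ with domain the set of all $u\in L_p(\mu)$ for which the limit exists. For $0<\sigma<2$ let $H_p^\sigma(\mu)$ be the image of $L_p(\mu)$ under $$(A_p+I)^{-\sigma/2}u=\frac1{\Gamma(\sigma/2)}\int_0^\infty t^{\sigma/2-1}e^{-t}\,T(t)u\,dt,$$ with norm $\|u\|_{H_p^\sigma(\mu)}=\|u\|_{L_p(\mu)}+\|A_p^{\sigma/2}u\|_{L_p(\mu)}$,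 and write $H^\sigma(\mu)=H_2^\sigma(\mu)$. Let $d_S>0$, $0<\beta<\delta<\min(d_S/2,\,1)$ and $p=\dfrac{d_S}{d_S-\delta}$. Assume: (i) (ultracontractivity with spectral dimension $d_S$) there are constants $C>0$ and $0<\omega\le1$ with $\|T(t)\|_{L_2(\mu)\to L_\infty(\mu)}\le C\,t^{-d_S/4}e^{\omega t}$ for all $t>0$; (ii) (heat kernel assumption) $T(t)$, $t>0$, admits transition densities, i.e. measurable non-negative functions $q(t,\cdot,\cdot)$ on $X\times X$ with $T(t)u(x)=\int_X q(t,x,y)u(y)\,\mu(dy)$ for $\mu$-a.e. $x$ and all $u\in L_2(\mu)$, and there are $R_0>0$, a number $w\ge2$ and bounded decreasing functions $\Phi_1,\Phi_2$ on $[0,\infty)$ such that $$t^{-d_f/w}\,\Phi_1\big(t^{-1/w}d(x,y)\big)\le q(t,x,y)\le t^{-d_f/w}\,\Phi_2\big(t^{-1/w}d(x,y)\big)$$ for all $x,y\in X$ and $0<t<R_0$, where $d_f<\infty$ is the Hausdorff dimension of $(X,d)$, $d_S=2d_f/w$, and $$\int_0^\infty s^{d_f+\beta/2-1}\,\Phi_2(s)\,ds<\infty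 .$$ Then there is a constant $c>0$ such that for all $u,v\in H^\delta(\mu)$ the product $uv$ belongs to $H_p^\beta(\mu)$ (and to the domain of $A_p^{\beta/2}$) and $$\|uv\|_{H_p^\beta(\mu)}\le c\,\|u\|_{H^\delta(\mu)}\,\|v\|_{H^\delta(\mu)} .$$ -/

import Mathlib

open MeasureTheory Filter Topology Set
open scoped ENNReal

noncomputable section

/-- `T` (used at times `t ≥ 0` only) is a strongly continuous symmetric Markovian semigroup of
bounded linear operators on the real space `L₂(μ)`. -/
structure IsSymmMarkovSemigroup {X : Type*} [MeasurableSpace X] (μ : Measure X)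
    (T : ℝ → (Lp ℝ 2 μ →L[ℝ] Lp ℝ 2 μ)) : Prop where
  zero : T 0 = ContinuousLinearMap.id ℝ (Lp ℝ 2 μ)
  add : ∀ s t : ℝ, 0 ≤ s → 0 ≤ t → T (t + s) = (T t).comp (T s)
  symm : ∀ t : ℝ, 0 ≤ t → ∀ u v : Lp ℝ 2 μ, inner ℝ (T t u) v = inner ℝ u (T t v)
  strongly_continuous : ∀ u : Lp ℝ 2 μ, Tendsto (fun t => T t u) (𝓝[>] 0) (𝓝 u)
  markov : ∀ t : ℝ, 0 ≤ t → ∀ u : Lp ℝ 2 μ,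
    (∀ᵐ x ∂μ, 0 ≤ u x ∧ u x ≤ 1) → ∀ᵐ x ∂μ, 0 ≤ T t u x ∧ T t u x ≤ 1

/-- `S` is a bounded operator on `L_p(μ)` that agrees with `R` on `L₂(μ) ∩ L_p(μ)`. -/
def IsLpExtension {X : Type*} [MeasurableSpace X] {μ : Measure X}
    (R : Lp ℝ 2 μ →L[ℝ] Lp ℝ 2 μ) (p : ℝ≥0∞) [Fact (1 ≤ p)]
    (S : Lp ℝ p μ →L[ℝ] Lp ℝ p μ) : Prop :=
  ∀ (f : X → ℝ) (h2 : MemLp f 2 μ) (hp : MemLp f p μ),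
    (S (hp.toLp f) : X → ℝ) =ᵐ[μ] (R (h2.toLp f) : X → ℝ)

open Classical in
/-- The semigroup induced by `T` on `L_p(μ)`, `1 ≤ p < ∞`: at time `t`, the bounded operator on
`L_p(μ)` that agrees with `T t` on the dense subspace `L₂(μ) ∩ L_p(μ)`. For a symmetric Markovian
semigroup it exists and is unique; the zero operator is a default value in the other case. -/
def lpSemigroup {X : Type*} [MeasurableSpace X] {μ : Measure X}
    (T : ℝ → (Lp ℝ 2 μ →L[ℝ] Lp ℝ 2 μ)) (p : ℝ≥0∞) [Fact (1 ≤ p)] :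
    ℝ → (Lp ℝ p μ →L[ℝ] Lp ℝ p μ) := fun t =>
  if h : ∃ S : Lp ℝ p μ →L[ℝ] Lp ℝ p μ, IsLpExtension (T t) p S then h.choose else 0

section Semigroup

variable {E : Type*} [NormedAddCommGroup E] [NormedSpace ℝ E]

/-- Let `-A` be the generator of the contraction semigroup `S` and `0 < α < 1`. This says that
`u` belongs to the domain of `A ^ α` and `A ^ α u = w`:
`w = lim_{ε → 0} Γ(-α)⁻¹ ∫_ε^∞ t^(-α-1) (S t u - u) dt` in the norm of `E`. -/
def HasFracPow (S : ℝ → (E →L[ℝ] E)) (α : ℝ) (u w : E) : Prop :=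
  Tendsto (fun ε : ℝ => (Real.Gamma (-α))⁻¹ • ∫ t in Ioi ε, t ^ (-α - 1) • (S t u - u))
    (𝓝[>] 0) (𝓝 w)

/-- The domain of `A ^ α`. -/
def fracDomain (S : ℝ → (E →L[ℝ] E)) (α : ℝ) : Set E := {u | ∃ w, HasFracPow S α u w}

open Classical in
/-- `A ^ α u` for `u` in the domain of `A ^ α`. -/
def fracPow (S : ℝ → (E →L[ℝ] E)) (α : ℝ) (u : E) : E :=
  if h : ∃ w, HasFracPow S α u w then h.choose else 0

/-- The generalized Bessel potential operator `(A + I) ^ (-σ/2)`, `σ > 0`, that is,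
`Γ(σ/2)⁻¹ ∫_0^∞ t^(σ/2-1) e^(-t) S t u dt`; note that `e^(-t) S t` is the semigroup generated
by `-(A + I)`. -/
def besselPotential (S : ℝ → (E →L[ℝ] E)) (σ : ℝ) (u : E) : E :=
  (Real.Gamma (σ / 2))⁻¹ • ∫ t in Ioi (0 : ℝ), (t ^ (σ / 2 - 1) * Real.exp (-t)) • S t u

/-- The potential space `H^σ`, `0 < σ < 2`: the image of `E` under `(A + I) ^ (-σ/2)`. -/
def potentialSpace (S : ℝ → (E →L[ℝ] E)) (σ : ℝ) : Set E := range (besselPotential S σ)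

/-- The norm of `H^σ`, `0 < σ < 2`: `‖u‖ + ‖A ^ (σ/2) u‖`. -/
def potentialNorm (S : ℝ → (E →L[ℝ] E)) (σ : ℝ) (u : E) : ℝ := ‖u‖ + ‖fracPow S (σ / 2) u‖

end Semigroup

/-- (Local) ultracontractivity with spectral dimension `dS`:
`‖T t‖_{L₂ → L_∞} ≤ c t^(-dS/4) e^(ω t)` for all `t > 0`. -/
def IsUltracontractive {X : Type*} [MeasurableSpace X] {μ : Measure X}
    (T : ℝ → (Lp ℝ 2 μ →L[ℝ] Lp ℝ 2 μ)) (dS : ℝ) : Prop :=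
  ∃ c ω : ℝ, 0 < c ∧ 0 < ω ∧ ω ≤ 1 ∧ ∀ t : ℝ, 0 < t → ∀ u : Lp ℝ 2 μ,
    eLpNorm (T t u) ∞ μ ≤ ENNReal.ofReal (c * t ^ (-dS / 4) * Real.exp (ω * t)) * eLpNorm u 2 μ

/-- `q t x y` are transition densities of `T` with respect to `μ`. -/
structure IsTransitionDensity {X : Type*} [MeasurableSpace X] {μ : Measure X}
    (T : ℝ → (Lp ℝ 2 μ →L[ℝ] Lp ℝ 2 μ)) (q : ℝ → X → X → ℝ) : Prop where
  measurable : ∀ t : ℝ, 0 < t → Measurable (fun z : X × X => q t z.1 z.2)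
  nonneg : ∀ t : ℝ, 0 < t → ∀ x y : X, 0 ≤ q t x y
  repr : ∀ t : ℝ, 0 < t → ∀ u : Lp ℝ 2 μ, ∀ᵐ x ∂μ,
    Integrable (fun y => q t x y * u y) μ ∧ T t u x = ∫ y, q t x y * u y ∂μ

/-- `Φ` is bounded and decreasing (in the wide sense) on `[0, ∞)`. -/
def IsBoundedDecreasing (Φ : ℝ → ℝ) : Prop :=
  AntitoneOn Φ (Ici 0) ∧ ∃ M : ℝ, ∀ s : ℝ, 0 ≤ s → |Φ s| ≤ M

/-- The heat kernel assumption: two-sided bounds on transition densities for small times, where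
`df` is the Hausdorff dimension of the space, `w ≥ 2`, `dS = 2 df / w`, together with the
integral condition `∫_0^∞ s^(df + β/2 - 1) Φ₂(s) ds < ∞`. -/
def HeatKernelAssumption {X : Type*} [MetricSpace X] [MeasurableSpace X] {μ : Measure X}
    (T : ℝ → (Lp ℝ 2 μ →L[ℝ] Lp ℝ 2 μ)) (dS β : ℝ) : Prop :=
  ∃ (q : ℝ → X → X → ℝ) (Φ₁ Φ₂ : ℝ → ℝ) (R₀ df w : ℝ),
    IsTransitionDensity T q ∧
    IsBoundedDecreasing Φ₁ ∧ IsBoundedDecreasing Φ₂ ∧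
    0 < R₀ ∧ 0 ≤ df ∧ dimH (univ : Set X) = ENNReal.ofReal df ∧ 2 ≤ w ∧ dS = 2 * df / w ∧
    (∀ t : ℝ, 0 < t → t < R₀ → ∀ x y : X,
      t ^ (-df / w) * Φ₁ (t ^ (-1 / w) * dist x y) ≤ q t x y ∧
      q t x y ≤ t ^ (-df / w) * Φ₂ (t ^ (-1 / w) * dist x y)) ∧
    IntegrableOn (fun s : ℝ => s ^ (df + β / 2 - 1) * Φ₂ s) (Ioi 0)

end

/-!
Write `E = L₂(μ)` or `E = L_p(μ)`, let `S` be the semigroup on `E`, and let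
`B^(-a) = Γ(a)⁻¹ ∫_0^∞ s^(a-1) e^(-s) S s ds` be the Bessel potential operator, `B = A + I`.

For a strongly continuous contraction semigroup on any Banach space, the potential space of order
`2 a` is the domain of `A ^ a`, and the graph norm of `A ^ a` controls the norm of the preimage
under `B^(-a)`. Both facts come from one computation: the truncated integral
`∫_ε^∞ t^(-a-1) (e^(-t) S t - I) dt` composed with `B^(-a)` is the average of `e^(-r) S r` against
`ε⁻¹ k(r/ε) dr`, where `k` is an explicit, negative, integrable function. Letting `ε` tend to `0`
gives a nonzero multiple of the identity (`IsContrSemigroup.tendsto_integral_damped_bessel`). The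
factor `e^(-t)` changes the truncated integrals by a convergent term only. Bessel potentials
`u = B^(-a) f` satisfy `‖S t u - u‖ = O(t^a)`, and conversely `‖S t w - w‖ = O(t^γ)` with `γ > b`
puts `w` into the domain of `A ^ b`. It therefore suffices to show, for `u` and `v` in `H^δ`, that
`‖T t (u v) - u v‖_p = O(t^γ)` for some `γ > β/2`.

With the transition density, up to null sets,
`T t (u v)(x) - u v (x) = ∫ (u(y) - u(x)) v(y) q(t,x,y) μ(dy) + u(x) (T t v(x) - v(x))`,
so that the Cauchy–Schwarz inequality bounds its modulus by
`V(x) (T t (v²)(x))^(1/2) + |u(x)| |T t v(x) - v(x)|` with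
`V(x)² = ∫ (u(y) - u(x))² q(t,x,y) μ(dy)`. Here
`‖V‖₂² ≤ 2 ⟪u - T t u, u⟫`, and both `‖V‖₂` and `‖T t v - v‖₂` are `O(t^(δ/2))`; for the energy
`⟪u - T t u, u⟫` this follows from `‖u - T t u‖₂ = O(t^(δ/2))` by a doubling argument that uses
`δ < 1` (`inner_sub_semigroup_le`).

If `u` and `v` were known to lie in `L_r` with the critical exponent `1/r = 1/2 - δ/dS`, Hölder's
inequality would end the proof with `γ = δ/2`. Since `β < δ`, a subcritical embedding is enough, and
it follows from ultracontractivity and Minkowski's integral inequality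
(`exists_eLpNorm_bessel_le`): one interpolates `V` and `T t v - v` between `L₂`, where they are
small, and `L_r`, where they are bounded, with a parameter `θ` that reduces `γ` to
`(1 - θ) δ/2 > β/2`.

The rows of the transition density have mass at most `1` by the Markov property, and so have its
columns by symmetry. Together with Jensen's inequality this makes the integral operators
contractions of every `L_p` and produces the semigroup on `L_p` itself.
-/

noncomputable section

/-! ### The scalar kernel of the fractional power formula -/

/-- The kernel `k` for which `∫_ε^∞ t^(-a-1) (B(t) - B(0)) dt = ∫_0^∞ ε⁻¹ k(r/ε) φ(r) dr`, where
`B(t) = ∫_0^∞ s^(a-1) φ(s+t) ds`. -/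
def fracKernel (a x : ℝ) : ℝ := ((max (x - 1) 0) ^ a - x ^ a) / (a * x)

lemma measurable_fracKernel (a : ℝ) : Measurable (fracKernel a) := by
  unfold fracKernel; fun_prop

lemma fracKernel_neg {a x : ℝ} (ha : 0 < a) (hx : 0 < x) : fracKernel a x < 0 := by
  unfold fracKernel
  apply div_neg_of_neg_of_pos _ (by positivity)
  rw [sub_neg]
  apply Real.rpow_lt_rpow (le_max_right _ _) _ ha
  rcases max_cases (x - 1) 0 with h | h <;> linarith

/-- The decay `x^(a-2)` at infinity rests on the cancellation between `(x-1)^a` and `x^a`. -/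
lemma abs_fracKernel_le {a x : ℝ} (ha : 0 < a) (ha1 : a < 1) (hx : 0 < x) :
    |fracKernel a x| ≤ if x ≤ 1 then a⁻¹ * x ^ (a - 1) else a⁻¹ * x ^ (a - 2) := by
  rw [abs_of_neg (fracKernel_neg ha hx)]
  unfold fracKernel
  have h1 : x ^ (a - 1) = x ^ a / x := Real.rpow_sub_one hx.ne' a
  have h2 : x ^ (a - 2) = x ^ a / x / x := by
    rw [show a - 2 = a - 1 - 1 by ring, Real.rpow_sub_one hx.ne', h1]
  split_ifs with h
  · rw [max_eq_right (by linarith), Real.zero_rpow ha.ne', h1]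
    apply le_of_eq; field_simp; ring
  · push Not at h
    rw [max_eq_left (by linarith), h2]
    have hx0 : 0 < x ^ a := by positivity
    -- `1 - 1/x ≤ (1 - 1/x)^a`, as the base lies in `[0, 1]` and `a ≤ 1`.
    have h3 : x ^ a * (1 - x⁻¹) ≤ (x - 1) ^ a := by
      have hx1 : x⁻¹ < 1 := inv_lt_one_of_one_lt₀ h
      have : x - 1 = x * (1 - x⁻¹) := by field_simp
      rw [this, Real.mul_rpow hx.le (by linarith)]
      gcongr
      have := Real.rpow_le_rpow_of_exponent_ge (x := 1 - x⁻¹) (by linarith)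
        (by linarith [inv_pos.2 hx]) ha1.le
      simpa using this
    rw [← neg_div, div_le_iff₀ (by positivity)]
    have : a⁻¹ * (x ^ a / x / x) * (a * x) = x ^ a * x⁻¹ := by field_simp
    rw [this]; linarith

lemma integrableOn_fracKernel {a : ℝ} (ha : 0 < a) (ha1 : a < 1) :
    IntegrableOn (fracKernel a) (Ioi 0) := by
  have hm := (measurable_fracKernel a).aestronglyMeasurable (μ := volume)
  rw [← Ioc_union_Ioi_eq_Ioi (zero_le_one' ℝ)]
  refine IntegrableOn.union ?_ ?_
  · have : IntegrableOn (fun x : ℝ => a⁻¹ * x ^ (a - 1)) (Ioc 0 1) :=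
      ((intervalIntegrable_iff_integrableOn_Ioc_of_le zero_le_one).1
        (intervalIntegral.intervalIntegrable_rpow' (by linarith))).const_mul _
    refine Integrable.mono' this hm.restrict ?_
    refine (ae_restrict_iff' measurableSet_Ioc).2 (Eventually.of_forall fun x hx => ?_)
    simpa [hx.2] using abs_fracKernel_le ha ha1 hx.1
  · have : IntegrableOn (fun x : ℝ => a⁻¹ * x ^ (a - 2)) (Ioi 1) :=
      (integrableOn_Ioi_rpow_of_lt (by linarith) zero_lt_one).const_mul _
    refine Integrable.mono' this hm.restrict ?_
    refine (ae_restrict_iff' measurableSet_Ioi).2 (Eventually.of_forall fun x hx => ?_)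
    simpa [not_le.2 (mem_Ioi.1 hx)] using
      abs_fracKernel_le ha ha1 (zero_lt_one.trans (mem_Ioi.1 hx))

lemma integral_fracKernel_neg {a : ℝ} (ha : 0 < a) (ha1 : a < 1) :
    ∫ x in Ioi 0, fracKernel a x < 0 := by
  have h : 0 < ∫ x in Ioi 0, -fracKernel a x := by
    rw [setIntegral_pos_iff_support_of_nonneg_ae]
    · have : Function.support (fun x => -fracKernel a x) ∩ Ioi 0 = Ioi 0 := by
        apply inter_eq_right.2
        intro x hx
        simpa using (fracKernel_neg ha hx).ne
      rw [this]; simp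
    · refine (ae_restrict_iff' measurableSet_Ioi).2 (Eventually.of_forall fun x hx => ?_)
      simpa using (fracKernel_neg ha hx).le
    · exact (integrableOn_fracKernel ha ha1).neg
  rw [integral_neg] at h
  linarith

/-- `t ↦ -((r-t)/t)^a / (a r)` is a primitive of the integrand. -/
lemma integral_rpow_mul_sub_rpow {a ε r : ℝ} (ha : 0 < a) (hε : 0 < ε) (hr : ε ≤ r) :
    ∫ t in ε..r, t ^ (-a - 1) * (r - t) ^ (a - 1) = ((r - ε) / ε) ^ a / (a * r) := by
  have hr0 : 0 < r := hε.trans_le hr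
  have hc : ContinuousOn (fun t => -(((r - t) / t) ^ a / (a * r))) (Icc ε r) := by
    apply ContinuousOn.neg
    apply ContinuousOn.div_const
    apply ContinuousOn.rpow_const _ (fun x _ => Or.inr ha.le)
    apply ContinuousOn.div (by fun_prop) (by fun_prop)
    intro x hx; linarith [hx.1]
  have hd : ∀ t ∈ Ioo ε r, HasDerivAt (fun t => -(((r - t) / t) ^ a / (a * r)))
      (t ^ (-a - 1) * (r - t) ^ (a - 1)) t := by
    intro t ht
    have ht0 : 0 < t := hε.trans ht.1
    have hrt : 0 < r - t := sub_pos.2 ht.2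
    have h1 : HasDerivAt (fun t => (r - t) / t) (((0 - 1) * t - (r - t) * 1) / t ^ 2) t :=
      ((hasDerivAt_const t r).sub (hasDerivAt_id t)).div (hasDerivAt_id t) ht0.ne'
    have h2 := ((h1.rpow_const (p := a) (Or.inl (by positivity))).div_const (a * r)).neg
    refine h2.congr_deriv ?_
    rw [Real.div_rpow hrt.le ht0.le, show -a - 1 = -(a - 1) - 2 by ring, 
      Real.rpow_sub ht0 (-(a - 1)) 2, Real.rpow_neg ht0.le, show t ^ (2 : ℝ) = t ^ 2 by norm_cast]
    field_simp; ring
  have hint : IntegrableOn (fun t => t ^ (-a - 1) * (r - t) ^ (a - 1)) (Ioc ε r) := by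
    refine intervalIntegral.integrableOn_deriv_of_nonneg hc hd ?_
    intro t ht
    have ht0 : 0 < t := hε.trans ht.1
    have hrt : 0 < r - t := sub_pos.2 ht.2
    positivity
  rw [intervalIntegral.integral_eq_sub_of_hasDerivAt_of_le hr hc hd
    ((intervalIntegrable_iff_integrableOn_Ioc_of_le hr).2 hint)]
  simp [Real.zero_rpow ha.ne']

lemma setIntegral_rpow_mul_indicator {a ε r : ℝ} (ha : 0 < a) (hε : 0 < ε) :
    ∫ t in Ioi ε, t ^ (-a - 1) * (Ioi t).indicator (fun r => (r - t) ^ (a - 1)) r =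
      (max (r - ε) 0 / ε) ^ a / (a * r) := by
  have h1 : ∀ t, t ^ (-a - 1) * (Ioi t).indicator (fun r => (r - t) ^ (a - 1)) r =
      (Iio r).indicator (fun t => t ^ (-a - 1) * (r - t) ^ (a - 1)) t := by
    intro t
    by_cases h : t < r <;> simp [indicator, h]
  simp_rw [h1]
  rw [setIntegral_indicator measurableSet_Iio, Ioi_inter_Iio]
  rcases le_or_gt ε r with h | h
  · rw [← integral_Ioc_eq_integral_Ioo, ← intervalIntegral.integral_of_le h,
      integral_rpow_mul_sub_rpow ha hε h, max_eq_left (by linarith)]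
  · rw [Ioo_eq_empty (by linarith), max_eq_right (by linarith)]
    simp [Real.zero_rpow ha.ne']

/-- The kernel that arises from Fubini's theorem is `ε⁻¹ k(r/ε)`. -/
lemma fracKernel_scale {a ε r : ℝ} (ha : 0 < a) (hε : 0 < ε) (hr : 0 < r) :
    (max (r - ε) 0 / ε) ^ a / (a * r) - ε ^ (-a) / a * r ^ (a - 1) =
      ε⁻¹ * fracKernel a (ε⁻¹ * r) := by
  unfold fracKernel
  have h1 : max (ε⁻¹ * r - 1) 0 = max (r - ε) 0 / ε := by
    rw [← max_div_div_right hε.le]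
    congr 1
    · field_simp
    · simp
  rw [h1, Real.mul_rpow (by positivity) hr.le, Real.inv_rpow hε.le, Real.rpow_neg hε.le,
    Real.rpow_sub_one hr.ne']
  field_simp

lemma integrableOn_shift {E : Type*} [NormedAddCommGroup E] {f : ℝ → E} {t : ℝ} :
    IntegrableOn (fun s => f (s + t)) (Ioi 0) ↔ IntegrableOn f (Ioi t) := by
  have := (measurePreserving_add_right volume t).integrableOn_comp_preimage
    (measurableEmbedding_addRight t) (f := f) (s := Ioi t)
  simpa [Function.comp_def] using this

section

variable {E : Type*} [NormedAddCommGroup E] [NormedSpace ℝ E]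

lemma integrableOn_rpow_mul_exp {a : ℝ} (ha : 0 < a) :
    IntegrableOn (fun s : ℝ => s ^ (a - 1) * Real.exp (-s)) (Ioi 0) := by
  simpa [mul_comm] using Real.GammaIntegral_convergent ha

lemma integral_rpow_mul_exp {a : ℝ} (ha : 0 < a) :
    ∫ s in Ioi (0 : ℝ), s ^ (a - 1) * Real.exp (-s) = Real.Gamma a := by
  simpa [mul_comm] using (Real.Gamma_eq_integral ha).symm

lemma integrableOn_rpow_smul_shift {φ : ℝ → E} {M a t : ℝ} (hφ : ContinuousOn φ (Ioi 0))
    (hM : ∀ r, 0 < r → ‖φ r‖ ≤ M * Real.exp (-r)) (ha : 0 < a) (ht : 0 ≤ t) :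
    IntegrableOn (fun s => s ^ (a - 1) • φ (s + t)) (Ioi 0) := by
  have hM0 : 0 ≤ M := by
    have := (norm_nonneg _).trans (hM 1 one_pos)
    exact nonneg_of_mul_nonneg_left this (Real.exp_pos _)
  refine Integrable.mono' ((integrableOn_rpow_mul_exp ha).const_mul M) ?_ ?_
  · refine ContinuousOn.aestronglyMeasurable ?_ measurableSet_Ioi
    apply ContinuousOn.smul
    · exact continuousOn_id.rpow_const fun x hx => Or.inl (ne_of_gt hx)
    · exact hφ.comp (by fun_prop) fun x hx => by
        simp only [mem_Ioi] at hx ⊢; linarith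
  · refine (ae_restrict_iff' measurableSet_Ioi).2 (Eventually.of_forall fun s hs => ?_)
    have hs : 0 < s := hs
    rw [norm_smul, Real.norm_of_nonneg (by positivity)]
    calc s ^ (a - 1) * ‖φ (s + t)‖ ≤ s ^ (a - 1) * (M * Real.exp (-(s + t))) := by
          gcongr; exact hM _ (by linarith)
      _ ≤ s ^ (a - 1) * (M * Real.exp (-s)) := by gcongr; linarith
      _ = _ := by ring

lemma setIntegral_shift (f : ℝ → E) (t : ℝ) :
    ∫ s in Ioi (0 : ℝ), f (s + t) = ∫ r in Ioi t, f r := by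
  have := (measurePreserving_add_right volume t).setIntegral_preimage_emb
    (measurableEmbedding_addRight t) f (Ioi t)
  simpa using this

lemma setIntegral_shift_rpow (φ : ℝ → E) {a t : ℝ} (ht : 0 ≤ t) :
    ∫ s in Ioi (0 : ℝ), s ^ (a - 1) • φ (s + t) =
      ∫ r in Ioi 0, (Ioi t).indicator (fun r => (r - t) ^ (a - 1)) r • φ r := by
  have := setIntegral_shift (fun r => (r - t) ^ (a - 1) • φ r) t
  simp only [add_sub_cancel_right] at this
  rw [this]
  simp_rw [← indicator_smul_apply_left]
  rw [setIntegral_indicator measurableSet_Ioi, Ioi_inter_Ioi, sup_of_le_right ht]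

lemma integrableOn_indicator_rpow_smul {φ : ℝ → E} {M a t : ℝ} (hφ : ContinuousOn φ (Ioi 0))
    (hM : ∀ r, 0 < r → ‖φ r‖ ≤ M * Real.exp (-r)) (ha : 0 < a) (ht : 0 ≤ t) :
    IntegrableOn (fun r => (Ioi t).indicator (fun r => (r - t) ^ (a - 1)) r • φ r) (Ioi 0) := by
  have := integrableOn_rpow_smul_shift hφ hM ha ht
  have h2 := (integrableOn_shift (f := fun r => (r - t) ^ (a - 1) • φ r) (t := t)).1
    (by simpa using this)
  have h3 : (fun r => (Ioi t).indicator (fun r => (r - t) ^ (a - 1)) r • φ r) =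
      (Ioi t).indicator (fun r => (r - t) ^ (a - 1) • φ r) := by
    ext r; by_cases h : t < r <;> simp [indicator, h]
  rw [h3]
  exact (integrable_indicator_iff measurableSet_Ioi).2 h2 |>.integrableOn

end

section

variable {E : Type*} [NormedAddCommGroup E] [NormedSpace ℝ E]

/-- Integrability of the double integral, as needed for Fubini's theorem. -/
lemma integrable_fracKernel_prod {φ : ℝ → E} {M a ε : ℝ} (hφ : ContinuousOn φ (Ioi 0))
    (hM : ∀ r, 0 < r → ‖φ r‖ ≤ M * Real.exp (-r)) (ha : 0 < a) (hε : 0 < ε) :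
    Integrable (Function.uncurry fun t r : ℝ =>
      (t ^ (-a - 1) * (Ioi t).indicator (fun r => (r - t) ^ (a - 1)) r) • φ r)
      ((volume.restrict (Ioi ε)).prod (volume.restrict (Ioi 0))) := by
  have hmeas : Measurable fun z : ℝ × ℝ =>
      z.1 ^ (-a - 1) * (Ioi z.1).indicator (fun r => (r - z.1) ^ (a - 1)) z.2 := by
    apply Measurable.mul (by fun_prop)
    have : (fun z : ℝ × ℝ => (Ioi z.1).indicator (fun r => (r - z.1) ^ (a - 1)) z.2) =
        {z : ℝ × ℝ | z.1 < z.2}.indicator (fun z => (z.2 - z.1) ^ (a - 1)) := by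
      ext z; by_cases h : z.1 < z.2 <;> simp [indicator, h]
    rw [this]
    exact Measurable.indicator (by fun_prop) (measurableSet_lt measurable_fst measurable_snd)
  have hφm : AEStronglyMeasurable φ (volume.restrict (Ioi 0)) :=
    hφ.aestronglyMeasurable measurableSet_Ioi
  have hsm : AEStronglyMeasurable (Function.uncurry fun t r : ℝ =>
      (t ^ (-a - 1) * (Ioi t).indicator (fun r => (r - t) ^ (a - 1)) r) • φ r)
      ((volume.restrict (Ioi ε)).prod (volume.restrict (Ioi 0))) :=
    hmeas.aestronglyMeasurable.smul hφm.comp_snd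
  have hnorm : ∀ t ∈ Ioi ε, ∀ r, ‖(t ^ (-a - 1) * (Ioi t).indicator
      (fun r => (r - t) ^ (a - 1)) r) • φ r‖ =
      t ^ (-a - 1) * ((Ioi t).indicator (fun r => (r - t) ^ (a - 1)) r • ‖φ r‖) := by
    intro t ht r
    have ht0 : 0 < t := hε.trans ht
    rw [norm_smul, Real.norm_of_nonneg, smul_eq_mul, mul_assoc]
    apply mul_nonneg (by positivity)
    apply indicator_nonneg
    intro x hx
    have : 0 < x - t := sub_pos.2 hx
    positivity
  have hM' : ∀ r, 0 < r → ‖‖φ r‖‖ ≤ M * Real.exp (-r) := by simpa using hM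
  rw [integrable_prod_iff hsm]
  constructor
  · refine (ae_restrict_iff' measurableSet_Ioi).2 (Eventually.of_forall fun t ht => ?_)
    have ht0 : 0 < t := hε.trans ht
    simp only [Function.uncurry, mul_smul]
    exact Integrable.smul (t ^ (-a - 1)) (integrableOn_indicator_rpow_smul hφ hM ha ht0.le)
  · refine Integrable.mono' (((integrableOn_Ioi_rpow_of_lt (a := -a - 1) (by linarith)
      hε).mul_const (M * Real.Gamma a))) hsm.norm.integral_prod_right' ?_
    refine (ae_restrict_iff' measurableSet_Ioi).2 (Eventually.of_forall fun t ht => ?_)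
    have ht0 : 0 < t := hε.trans ht
    simp only [Function.uncurry]
    simp_rw [hnorm t ht]
    rw [integral_const_mul, ← setIntegral_shift_rpow _ ht0.le, norm_mul,
      Real.norm_of_nonneg (by positivity : 0 ≤ t ^ (-a - 1))]
    gcongr
    rw [← integral_rpow_mul_exp ha, ← integral_const_mul]
    apply norm_integral_le_of_norm_le ((integrableOn_rpow_mul_exp ha).const_mul M)
    refine (ae_restrict_iff' measurableSet_Ioi).2 (Eventually.of_forall fun s hs => ?_)
    have hs : 0 < s := hs
    have hM0 : 0 ≤ M := by
      have := (norm_nonneg _).trans (hM 1 one_pos)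
      exact nonneg_of_mul_nonneg_left this (Real.exp_pos _)
    rw [norm_smul, Real.norm_of_nonneg (by positivity)]
    calc s ^ (a - 1) * ‖‖φ (s + t)‖‖ ≤ s ^ (a - 1) * (M * Real.exp (-(s + t))) := by
          gcongr; exact hM' _ (by linarith)
      _ ≤ s ^ (a - 1) * (M * Real.exp (-s)) := by gcongr; linarith
      _ = _ := by ring

/-- The truncated fractional derivative of order `a` of the fractional integral of order `a` of `φ`
is an average of `φ` against `ε⁻¹ k(r/ε)`. -/
lemma integral_rpow_smul_increment_eq [CompleteSpace E] {φ : ℝ → E} {M a ε : ℝ}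
    (hφ : ContinuousOn φ (Ioi 0))
    (hM : ∀ r, 0 < r → ‖φ r‖ ≤ M * Real.exp (-r)) (ha : 0 < a) (hε : 0 < ε) :
    ∫ t in Ioi ε, t ^ (-a - 1) • ((∫ s in Ioi (0 : ℝ), s ^ (a - 1) • φ (s + t)) -
      ∫ s in Ioi (0 : ℝ), s ^ (a - 1) • φ s) =
    ∫ r in Ioi 0, (ε⁻¹ * fracKernel a (ε⁻¹ * r)) • φ r := by
  have hF := integrable_fracKernel_prod hφ hM ha hε
  have h0 : IntegrableOn (fun s => s ^ (a - 1) • φ s) (Ioi 0) := by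
    simpa using integrableOn_rpow_smul_shift hφ hM ha le_rfl
  have hfst : ∀ t ∈ Ioi ε, t ^ (-a - 1) • (∫ s in Ioi (0 : ℝ), s ^ (a - 1) • φ (s + t)) =
      ∫ r in Ioi 0, (t ^ (-a - 1) * (Ioi t).indicator (fun r => (r - t) ^ (a - 1)) r) • φ r := by
    intro t ht
    have ht0 : 0 < t := hε.trans ht
    rw [setIntegral_shift_rpow _ ht0.le, ← integral_smul]
    simp_rw [mul_smul]
  have hsnd : ∀ r ∈ Ioi (0 : ℝ), ∫ t in Ioi ε,
      (t ^ (-a - 1) * (Ioi t).indicator (fun r => (r - t) ^ (a - 1)) r) • φ r =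
      ((max (r - ε) 0 / ε) ^ a / (a * r)) • φ r := by
    intro r hr
    rw [integral_smul_const, setIntegral_rpow_mul_indicator ha hε]
  have hI1 : IntegrableOn (fun t => t ^ (-a - 1) •
      (∫ s in Ioi (0 : ℝ), s ^ (a - 1) • φ (s + t))) (Ioi ε) :=
    hF.integral_prod_left.congr <| (ae_restrict_iff' measurableSet_Ioi).2 <|
      Eventually.of_forall fun t ht => (hfst t ht).symm
  have hI2 : IntegrableOn (fun r => ((max (r - ε) 0 / ε) ^ a / (a * r)) • φ r) (Ioi 0) :=
    hF.integral_prod_right.congr <| (ae_restrict_iff' measurableSet_Ioi).2 <|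
      Eventually.of_forall fun t ht => hsnd t ht
  have hI3 : IntegrableOn (fun t : ℝ => t ^ (-a - 1)) (Ioi ε) :=
    integrableOn_Ioi_rpow_of_lt (by linarith) hε
  have hI4 : IntegrableOn (fun r => (-ε ^ (-a - 1 + 1) / (-a - 1 + 1)) • r ^ (a - 1) • φ r)
      (Ioi 0) := Integrable.smul (-ε ^ (-a - 1 + 1) / (-a - 1 + 1)) h0
  simp_rw [smul_sub]
  rw [integral_sub hI1 (hI3.smul_const _), setIntegral_congr_fun measurableSet_Ioi hfst,
    integral_integral_swap hF, setIntegral_congr_fun measurableSet_Ioi hsnd, integral_smul_const,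
    integral_Ioi_rpow_of_lt (by linarith) hε, ← integral_smul,
    ← integral_sub hI2 hI4]
  refine setIntegral_congr_fun measurableSet_Ioi fun r hr => ?_
  have hr : 0 < r := hr
  rw [smul_smul, ← sub_smul, ← fracKernel_scale ha hε hr]
  congr 3
  rw [show -a - 1 + 1 = -a by ring, neg_div_neg_eq]

/-- The kernels `ε⁻¹ k(r/ε)` concentrate their mass at `0`. -/
lemma tendsto_integral_fracKernel_smul [CompleteSpace E] {φ : ℝ → E} {M a : ℝ} {x : E}
    (hφ : ContinuousOn φ (Ioi 0))
    (hM : ∀ r, 0 < r → ‖φ r‖ ≤ M) (hx : Tendsto φ (𝓝[>] 0) (𝓝 x)) (ha : 0 < a) (ha1 : a < 1) :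
    Tendsto (fun ε => ∫ r in Ioi 0, (ε⁻¹ * fracKernel a (ε⁻¹ * r)) • φ r) (𝓝[>] 0)
      (𝓝 ((∫ r in Ioi 0, fracKernel a r) • x)) := by
  have h1 : ∀ ε ∈ Ioi (0 : ℝ), ∫ r in Ioi 0, fracKernel a r • φ (ε * r) =
      ∫ r in Ioi 0, (ε⁻¹ * fracKernel a (ε⁻¹ * r)) • φ r := by
    intro ε hε
    have hε0 : ε ≠ 0 := ne_of_gt hε
    have := integral_comp_mul_left_Ioi (fun r => fracKernel a (ε⁻¹ * r) • φ r) 0 hε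
    simp only [mul_zero, inv_mul_cancel_left₀ hε0] at this
    rw [this, ← integral_smul]
    simp_rw [mul_smul]
  refine Tendsto.congr' (eventually_mem_nhdsWithin.mono h1) ?_
  rw [← integral_smul_const]
  refine tendsto_integral_filter_of_dominated_convergence (fun r => ‖fracKernel a r‖ * M) ?_ ?_
    ((integrableOn_fracKernel ha ha1).norm.mul_const M) ?_
  · filter_upwards [self_mem_nhdsWithin] with ε hε
    have hε : 0 < ε := hε
    refine (measurable_fracKernel a).aestronglyMeasurable.smul ?_
    refine ContinuousOn.aestronglyMeasurable ?_ measurableSet_Ioi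
    exact hφ.comp (by fun_prop) fun r (hr : 0 < r) => mul_pos hε hr
  · filter_upwards [self_mem_nhdsWithin] with ε hε
    refine (ae_restrict_iff' measurableSet_Ioi).2 (Eventually.of_forall fun r hr => ?_)
    rw [norm_smul]
    gcongr
    exact hM _ (mul_pos (mem_Ioi.1 hε) (mem_Ioi.1 hr))
  · refine (ae_restrict_iff' measurableSet_Ioi).2 (Eventually.of_forall fun r hr => ?_)
    refine (hx.comp ?_).const_smul _
    refine tendsto_nhdsWithin_iff.2 ⟨?_, ?_⟩
    · have : Tendsto (fun ε : ℝ => ε * r) (𝓝 0) (𝓝 (0 * r)) := tendsto_id.mul_const r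
      rw [zero_mul] at this
      exact this.mono_left nhdsWithin_le_nhds
    · filter_upwards [self_mem_nhdsWithin] with ε hε using mul_pos (mem_Ioi.1 hε) (mem_Ioi.1 hr)

end

/-! ### Contraction semigroups and Bessel potentials -/

/-- Deleting a shrinking neighbourhood of the end point of the domain of integration. -/
lemma tendsto_setIntegral_Ioi_zero {E : Type*} [NormedAddCommGroup E] [NormedSpace ℝ E]
    {f : ℝ → E} (hf : IntegrableOn f (Ioi 0)) :
    Tendsto (fun ε => ∫ t in Ioi ε, f t) (𝓝[>] 0) (𝓝 (∫ t in Ioi 0, f t)) := by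
  have h1 : ∀ ε ∈ Ioi (0 : ℝ), ∫ t in Ioi 0, (Ioi ε).indicator f t = ∫ t in Ioi ε, f t := by
    intro ε hε
    rw [setIntegral_indicator measurableSet_Ioi, Ioi_inter_Ioi, sup_of_le_right (le_of_lt hε)]
  refine Tendsto.congr' (eventually_mem_nhdsWithin.mono h1) ?_
  refine tendsto_integral_filter_of_dominated_convergence (fun t => ‖f t‖) ?_ ?_ hf.norm ?_
  · exact Eventually.of_forall fun ε => hf.aestronglyMeasurable.indicator measurableSet_Ioi
  · exact Eventually.of_forall fun ε =>
      Eventually.of_forall fun t => norm_indicator_le_norm_self _ _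
  · refine (ae_restrict_iff' measurableSet_Ioi).2 (Eventually.of_forall fun t ht => ?_)
    refine tendsto_const_nhds.congr' ?_
    filter_upwards [Ioo_mem_nhdsGT (show (0 : ℝ) < t from ht)] with ε hε
    simp [indicator, hε.2]

section

variable {E : Type*} [NormedAddCommGroup E] [NormedSpace ℝ E]

/-- Strongly continuous semigroups of contractions. Nothing is required of `S 0`. -/
structure IsContrSemigroup (S : ℝ → (E →L[ℝ] E)) : Prop where
  norm_le : ∀ t, 0 < t → ∀ u, ‖S t u‖ ≤ ‖u‖
  add : ∀ s t, 0 < s → 0 < t → ∀ u, S (s + t) u = S t (S s u)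
  tendsto : ∀ u, Tendsto (fun t => S t u) (𝓝[>] 0) (𝓝 u)

namespace IsContrSemigroup

variable {S : ℝ → (E →L[ℝ] E)} (hS : IsContrSemigroup S)
include hS

lemma norm_sub_le {s t : ℝ} (hs : 0 < s) (hst : s < t) (u : E) :
    ‖S t u - S s u‖ ≤ ‖S (t - s) u - u‖ := by
  have h := hS.add (t - s) s (sub_pos.2 hst) hs u
  rw [sub_add_cancel] at h
  rw [h, ← map_sub]
  exact hS.norm_le s hs _

lemma continuousOn (u : E) : ContinuousOn (fun t => S t u) (Ioi 0) := by
  rw [Metric.continuousOn_iff]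
  intro t ht ε hε
  have h := Metric.tendsto_nhdsWithin_nhds.1 (hS.tendsto u) ε hε
  obtain ⟨η, hη, h⟩ := h
  refine ⟨η, hη, fun s hs hst => ?_⟩
  have hs : 0 < s := hs
  have ht : 0 < t := ht
  rcases lt_trichotomy s t with hlt | rfl | hlt
  · have h1 := h (x := t - s) (sub_pos.2 hlt) (by
      rw [Real.dist_eq] at hst ⊢; rwa [sub_zero, abs_sub_comm])
    rw [dist_eq_norm] at h1
    rw [dist_comm, dist_eq_norm]
    exact (hS.norm_sub_le hs hlt u).trans_lt h1
  · simpa using hε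
  · have h1 := h (x := s - t) (sub_pos.2 hlt) (by
      rw [Real.dist_eq] at hst ⊢; rwa [sub_zero])
    rw [dist_eq_norm] at h1 ⊢
    exact (hS.norm_sub_le ht hlt u).trans_lt h1

lemma aestronglyMeasurable (u : E) {s : Set ℝ} (hs : MeasurableSet s) (h : s ⊆ Ioi 0) :
    AEStronglyMeasurable (fun t => S t u) (volume.restrict s) :=
  ((hS.continuousOn u).mono h).aestronglyMeasurable hs

lemma integrableOn_smul {m : ℝ → ℝ} {s : Set ℝ} (hs : MeasurableSet s) (h : s ⊆ Ioi 0)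
    (hm : IntegrableOn m s) (u : E) : IntegrableOn (fun t => m t • S t u) s := by
  refine Integrable.mono' (hm.norm.mul_const ‖u‖)
    (hm.aestronglyMeasurable.smul (hS.aestronglyMeasurable u hs h)) ?_
  refine (ae_restrict_iff' hs).2 (Eventually.of_forall fun t ht => ?_)
  rw [norm_smul]
  gcongr
  exact hS.norm_le t (h ht) u

lemma norm_integral_smul_le {m : ℝ → ℝ} {s : Set ℝ} (hs : MeasurableSet s) (h : s ⊆ Ioi 0)
    (hm : IntegrableOn m s) (u : E) : ‖∫ t in s, m t • S t u‖ ≤ (∫ t in s, ‖m t‖) * ‖u‖ := by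
  rw [← integral_mul_const]
  refine norm_integral_le_of_norm_le (hm.norm.mul_const ‖u‖) ?_
  refine (ae_restrict_iff' hs).2 (Eventually.of_forall fun t ht => ?_)
  rw [norm_smul]
  gcongr
  exact hS.norm_le t (h ht) u

lemma comm {s t : ℝ} (hs : 0 < s) (ht : 0 < t) (u : E) : S t (S s u) = S s (S t u) := by
  rw [← hS.add s t hs ht, ← hS.add t s ht hs, add_comm]

omit hS in
/-- The unnormalized Bessel potential `Γ(a) (A + I) ^ (-a)`. -/
def bessel (hS : IsContrSemigroup S) {a : ℝ} (ha : 0 < a) : E →L[ℝ] E :=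
  LinearMap.mkContinuous
    { toFun := fun u => ∫ s in Ioi (0 : ℝ), (s ^ (a - 1) * Real.exp (-s)) • S s u
      map_add' := fun u v => by
        have h := fun w => hS.integrableOn_smul measurableSet_Ioi Subset.rfl
          (integrableOn_rpow_mul_exp ha) w
        simp_rw [map_add, smul_add]
        exact integral_add (h u) (h v)
      map_smul' := fun c u => by
        simp_rw [map_smul, smul_comm _ c]
        exact integral_smul c _ }
    (Real.Gamma a) fun u => by
      refine (hS.norm_integral_smul_le measurableSet_Ioi Subset.rfl
        (integrableOn_rpow_mul_exp ha) u).trans_eq ?_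
      rw [← integral_rpow_mul_exp ha]
      congr 1
      refine setIntegral_congr_fun measurableSet_Ioi fun s hs => ?_
      have hs : 0 < s := hs
      exact Real.norm_of_nonneg (by positivity)

lemma bessel_apply {a : ℝ} (ha : 0 < a) (u : E) :
    hS.bessel ha u = ∫ s in Ioi (0 : ℝ), (s ^ (a - 1) * Real.exp (-s)) • S s u := rfl

lemma besselPotential_eq {a : ℝ} (ha : 0 < a) (u : E) :
    besselPotential S (2 * a) u = (Real.Gamma a)⁻¹ • hS.bessel ha u := by
  rw [bessel_apply, besselPotential, mul_div_cancel_left₀ a two_ne_zero]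

lemma integrableOn_increment {a ε : ℝ} (ha : 0 < a) (hε : 0 < ε) (u : E) :
    IntegrableOn (fun t => t ^ (-a - 1) • (S t u - u)) (Ioi ε) := by
  have h1 : IntegrableOn (fun t : ℝ => t ^ (-a - 1)) (Ioi ε) :=
    integrableOn_Ioi_rpow_of_lt (by linarith) hε
  simp_rw [smul_sub]
  exact (hS.integrableOn_smul measurableSet_Ioi (Ioi_subset_Ioi hε.le) h1 u).sub
    (h1.smul_const u)

omit hS in
lemma integrableOn_rpow_mul_one_sub_exp {a : ℝ} (ha : 0 < a) (ha1 : a < 1) :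
    IntegrableOn (fun t : ℝ => t ^ (-a - 1) * (1 - Real.exp (-t))) (Ioi 0) := by
  have hm : Measurable (fun t : ℝ => t ^ (-a - 1) * (1 - Real.exp (-t))) := by fun_prop
  rw [← Ioc_union_Ioi_eq_Ioi (zero_le_one' ℝ)]
  refine IntegrableOn.union ?_ ?_
  · have : IntegrableOn (fun x : ℝ => x ^ (-a)) (Ioc 0 1) :=
      ((intervalIntegrable_iff_integrableOn_Ioc_of_le zero_le_one).1
        (intervalIntegral.intervalIntegrable_rpow' (by linarith)))
    refine Integrable.mono' this hm.aestronglyMeasurable ?_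
    refine (ae_restrict_iff' measurableSet_Ioc).2 (Eventually.of_forall fun t ht => ?_)
    have ht0 : 0 < t := ht.1
    have h1 : 0 ≤ 1 - Real.exp (-t) := by simpa using ht0.le
    rw [Real.norm_of_nonneg (by positivity)]
    have h2 : 1 - Real.exp (-t) ≤ t := by linarith [Real.add_one_le_exp (-t)]
    calc t ^ (-a - 1) * (1 - Real.exp (-t)) ≤ t ^ (-a - 1) * t := by gcongr
      _ = t ^ (-a) := by rw [Real.rpow_sub_one ht0.ne']; field_simp
  · have : IntegrableOn (fun x : ℝ => x ^ (-a - 1)) (Ioi 1) :=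
      integrableOn_Ioi_rpow_of_lt (by linarith) zero_lt_one
    refine Integrable.mono' this hm.aestronglyMeasurable ?_
    refine (ae_restrict_iff' measurableSet_Ioi).2 (Eventually.of_forall fun t ht => ?_)
    have ht0 : 0 < t := zero_lt_one.trans ht
    have h1 : 0 ≤ 1 - Real.exp (-t) := by simpa using ht0.le
    rw [Real.norm_of_nonneg (by positivity)]
    exact mul_le_of_le_one_right (by positivity) (by linarith [Real.exp_pos (-t)])

/-- The truncated integral for `(A + I) ^ a`, without its constant, differs from that for `A ^ a`
by a convergent integral. -/
lemma integral_increment_eq {a ε : ℝ} (ha : 0 < a) (ha1 : a < 1) (hε : 0 < ε) (u : E) :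
    ∫ t in Ioi ε, t ^ (-a - 1) • (S t u - u) =
      (∫ t in Ioi ε, t ^ (-a - 1) • (Real.exp (-t) • S t u - u)) +
        ∫ t in Ioi ε, (t ^ (-a - 1) * (1 - Real.exp (-t))) • S t u := by
  have h1 := hS.integrableOn_increment ha hε u
  have h2 := (hS.integrableOn_smul measurableSet_Ioi Subset.rfl
    (integrableOn_rpow_mul_one_sub_exp ha ha1) u).mono_set (Ioi_subset_Ioi hε.le)
  rw [← sub_eq_iff_eq_add, ← integral_sub h1 h2]
  congr 1
  ext t
  module

lemma integrableOn_damped_increment {a ε : ℝ} (ha : 0 < a) (hε : 0 < ε) (u : E) :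
    IntegrableOn (fun t => t ^ (-a - 1) • (Real.exp (-t) • S t u - u)) (Ioi ε) := by
  have h1 : IntegrableOn (fun t : ℝ => t ^ (-a - 1)) (Ioi ε) :=
    integrableOn_Ioi_rpow_of_lt (by linarith) hε
  have h2 : IntegrableOn (fun t : ℝ => t ^ (-a - 1) * Real.exp (-t)) (Ioi ε) := by
    refine Integrable.mono' h1 (by fun_prop) ?_
    refine (ae_restrict_iff' measurableSet_Ioi).2 (Eventually.of_forall fun t ht => ?_)
    have ht0 : 0 < t := hε.trans ht
    rw [Real.norm_of_nonneg (by positivity)]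
    exact mul_le_of_le_one_right (by positivity) (by simpa using ht0.le)
  simp_rw [smul_sub, smul_smul]
  exact (hS.integrableOn_smul measurableSet_Ioi (Ioi_subset_Ioi hε.le) h2 u).sub
    (h1.smul_const u)

variable [CompleteSpace E]

lemma bessel_comm {a t : ℝ} (ha : 0 < a) (ht : 0 < t) (u : E) :
    hS.bessel ha (S t u) = S t (hS.bessel ha u) := by
  rw [bessel_apply, bessel_apply, ← (S t).integral_comp_comm
    (hS.integrableOn_smul measurableSet_Ioi Subset.rfl (integrableOn_rpow_mul_exp ha) u)]
  refine setIntegral_congr_fun measurableSet_Ioi fun s hs => ?_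
  simp only [map_smul]
  rw [hS.comm ht hs]

/-- The truncated integrals commute with the Bessel potential operator. -/
lemma bessel_integral_damped {a ε : ℝ} (ha : 0 < a) (hε : 0 < ε) (u : E) :
    hS.bessel ha (∫ t in Ioi ε, t ^ (-a - 1) • (Real.exp (-t) • S t u - u)) =
      ∫ t in Ioi ε, t ^ (-a - 1) •
        (Real.exp (-t) • S t (hS.bessel ha u) - hS.bessel ha u) := by
  rw [← (hS.bessel ha).integral_comp_comm (hS.integrableOn_damped_increment ha hε u)]
  refine setIntegral_congr_fun measurableSet_Ioi fun t ht => ?_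
  simp only [map_smul, map_sub]
  rw [hS.bessel_comm ha (hε.trans ht)]

lemma exp_smul_bessel {a t : ℝ} (ha : 0 < a) (ht : 0 < t) (u : E) :
    Real.exp (-t) • S t (hS.bessel ha u) =
      ∫ s in Ioi (0 : ℝ), s ^ (a - 1) • (Real.exp (-(s + t)) • S (s + t) u) := by
  rw [bessel_apply, ← (S t).integral_comp_comm
    (hS.integrableOn_smul measurableSet_Ioi Subset.rfl (integrableOn_rpow_mul_exp ha) u),
    ← integral_smul]
  refine setIntegral_congr_fun measurableSet_Ioi fun s hs => ?_
  simp only [map_smul]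
  rw [hS.add s t hs ht, smul_smul, smul_smul, neg_add, Real.exp_add]
  ring_nf

/-- The truncated integrals for `(A + I) ^ a` of a Bessel potential converge to a multiple of the
preimage. -/
lemma tendsto_integral_damped_bessel {a : ℝ} (ha : 0 < a) (ha1 : a < 1) (u : E) :
    Tendsto (fun ε => ∫ t in Ioi ε, t ^ (-a - 1) •
        (Real.exp (-t) • S t (hS.bessel ha u) - hS.bessel ha u)) (𝓝[>] 0)
      (𝓝 ((∫ r in Ioi 0, fracKernel a r) • u)) := by
  have hφ : ContinuousOn (fun r => Real.exp (-r) • S r u) (Ioi 0) :=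
    ContinuousOn.smul (by fun_prop) (hS.continuousOn u)
  have hM : ∀ r, 0 < r → ‖Real.exp (-r) • S r u‖ ≤ ‖u‖ * Real.exp (-r) := by
    intro r hr
    rw [norm_smul, Real.norm_of_nonneg (Real.exp_pos _).le, mul_comm]
    gcongr
    exact hS.norm_le r hr u
  have hM' : ∀ r, 0 < r → ‖Real.exp (-r) • S r u‖ ≤ ‖u‖ := fun r hr =>
    (hM r hr).trans (mul_le_of_le_one_right (norm_nonneg _) (by simpa using hr.le))
  have hx : Tendsto (fun r => Real.exp (-r) • S r u) (𝓝[>] 0) (𝓝 u) := by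
    have h1 : Tendsto (fun r : ℝ => Real.exp (-r)) (𝓝[>] 0) (𝓝 (Real.exp (-0))) :=
      (Continuous.tendsto (by fun_prop) 0).mono_left nhdsWithin_le_nhds
    simpa using h1.smul (hS.tendsto u)
  refine (tendsto_integral_fracKernel_smul hφ hM' hx ha ha1).congr' ?_
  filter_upwards [self_mem_nhdsWithin] with ε hε
  have hε : 0 < ε := hε
  rw [← integral_rpow_smul_increment_eq hφ hM ha hε]
  refine setIntegral_congr_fun measurableSet_Ioi fun t ht => ?_
  rw [hS.exp_smul_bessel ha (hε.trans ht), hS.bessel_apply]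
  simp_rw [smul_smul]

end IsContrSemigroup

end

/-! ### Domains of fractional powers and Bessel potential spaces -/

section

variable {E : Type*} [NormedAddCommGroup E] [NormedSpace ℝ E]

lemma HasFracPow.fracPow_eq {S : ℝ → (E →L[ℝ] E)} {a : ℝ} {u w : E} (h : HasFracPow S a u w) :
    fracPow S a u = w := by
  have hex : ∃ w, HasFracPow S a u w := ⟨w, h⟩
  rw [fracPow, dif_pos hex]
  exact tendsto_nhds_unique hex.choose_spec h

namespace IsContrSemigroup

variable {S : ℝ → (E →L[ℝ] E)} (hS : IsContrSemigroup S)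
include hS

lemma tendsto_integral_one_sub_exp {a : ℝ} (ha : 0 < a) (ha1 : a < 1) (u : E) :
    Tendsto (fun ε => ∫ t in Ioi ε, (t ^ (-a - 1) * (1 - Real.exp (-t))) • S t u) (𝓝[>] 0)
      (𝓝 (∫ t in Ioi 0, (t ^ (-a - 1) * (1 - Real.exp (-t))) • S t u)) :=
  tendsto_setIntegral_Ioi_zero (hS.integrableOn_smul measurableSet_Ioi Subset.rfl
    (integrableOn_rpow_mul_one_sub_exp ha ha1) u)

omit hS in
lemma gamma_neg_ne_zero {a : ℝ} (ha : 0 < a) (ha1 : a < 1) : Real.Gamma (-a) ≠ 0 := by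
  apply Real.Gamma_ne_zero
  intro m hm
  have h1 : a = m := by linarith
  rcases m with _ | m
  · simp at h1; linarith
  · push_cast at h1
    have : (0 : ℝ) ≤ m := m.cast_nonneg
    linarith

variable [CompleteSpace E]

/-- Bessel potentials of order `a` lie in the domain of `A ^ a`. The first term is `(A + I) ^ a`
applied to the potential, the second one the bounded difference `A ^ a - (A + I) ^ a`. -/
lemma hasFracPow_bessel {a : ℝ} (ha : 0 < a) (ha1 : a < 1) (h : E) :
    HasFracPow S a (hS.bessel ha h) ((Real.Gamma (-a))⁻¹ •
      ((∫ r in Ioi 0, fracKernel a r) • h +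
        ∫ t in Ioi 0, (t ^ (-a - 1) * (1 - Real.exp (-t))) • S t (hS.bessel ha h))) := by
  refine Tendsto.const_smul ?_ _
  refine ((hS.tendsto_integral_damped_bessel ha ha1 h).add
    (hS.tendsto_integral_one_sub_exp ha ha1 _)).congr' ?_
  filter_upwards [self_mem_nhdsWithin] with ε hε
  exact (hS.integral_increment_eq ha ha1 hε _).symm

/-- The graph norm of `A ^ a` controls the norm of the preimage under the Bessel potential. -/
lemma exists_norm_le_potentialNorm {a : ℝ} (ha : 0 < a) (ha1 : a < 1) :
    ∃ C : ℝ, 0 < C ∧ ∀ h : E,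
      ‖h‖ ≤ C * potentialNorm S (2 * a) (besselPotential S (2 * a) h) := by
  set κ := ∫ r in Ioi 0, fracKernel a r with hκ
  have hκ0 : κ < 0 := integral_fracKernel_neg ha ha1
  set L := ∫ t in Ioi (0 : ℝ), ‖t ^ (-a - 1) * (1 - Real.exp (-t))‖ with hL
  have hL0 : 0 ≤ L := integral_nonneg fun _ => norm_nonneg _
  set G := |Real.Gamma (-a)| with hG
  have hG0 : 0 < G := abs_pos.2 (gamma_neg_ne_zero ha ha1)
  have hΓ : 0 < Real.Gamma a := Real.Gamma_pos_of_pos ha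
  have hpos : 0 < |κ|⁻¹ * (G + L) * Real.Gamma a := by
    have := abs_pos.2 hκ0.ne; positivity
  refine ⟨|κ|⁻¹ * (G + L) * Real.Gamma a, hpos, fun h => ?_⟩
  suffices H : ∀ h : E, ‖h‖ ≤ |κ|⁻¹ * (G + L) * potentialNorm S (2 * a) (hS.bessel ha h) by
    have h2 := H ((Real.Gamma a)⁻¹ • h)
    rw [map_smul, ← hS.besselPotential_eq ha, norm_smul, norm_inv,
      Real.norm_of_nonneg hΓ.le] at h2
    calc ‖h‖ = Real.Gamma a * ((Real.Gamma a)⁻¹ * ‖h‖) := by field_simp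
      _ ≤ Real.Gamma a * (|κ|⁻¹ * (G + L) *
          potentialNorm S (2 * a) (besselPotential S (2 * a) h)) := by gcongr
      _ = _ := by ring
  intro h
  set u := hS.bessel ha h with hudef
  set R := ∫ t in Ioi 0, (t ^ (-a - 1) * (1 - Real.exp (-t))) • S t u with hR
  have hRle : ‖R‖ ≤ L * ‖u‖ := hS.norm_integral_smul_le measurableSet_Ioi Subset.rfl
    (integrableOn_rpow_mul_one_sub_exp ha ha1) u
  have hw := (hS.hasFracPow_bessel ha ha1 h).fracPow_eq
  rw [← hudef, ← hκ, ← hR] at hw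
  have h1 : κ • h = Real.Gamma (-a) • fracPow S a u - R := by
    rw [hw, smul_smul, mul_inv_cancel₀ (gamma_neg_ne_zero ha ha1), one_smul, add_sub_cancel_right]
  have h2 : |κ| * ‖h‖ ≤ G * ‖fracPow S a u‖ + L * ‖u‖ := by
    rw [← Real.norm_eq_abs, ← norm_smul, h1]
    refine (_root_.norm_sub_le _ _).trans ?_
    rw [norm_smul, Real.norm_eq_abs]
    gcongr
  rw [potentialNorm, mul_div_cancel_left₀ a two_ne_zero, mul_assoc,
    ← div_eq_inv_mul, le_div_iff₀ (abs_pos.2 hκ0.ne), mul_comm]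
  refine h2.trans ?_
  nlinarith [norm_nonneg u, norm_nonneg (fracPow S a u)]

/-- The truncated integrals `J ε u` for `(A + I) ^ a` converge to some `g`, hence their Bessel
potentials converge to that of `g`. Since `J ε` commutes with the Bessel potential operator, these
also converge to a nonzero multiple of `u`. -/
lemma mem_potentialSpace_of_mem_fracDomain {a : ℝ} (ha : 0 < a) (ha1 : a < 1) {u : E}
    (hu : u ∈ fracDomain S a) : u ∈ potentialSpace S (2 * a) := by
  obtain ⟨w, hw⟩ := hu
  set κ := ∫ r in Ioi 0, fracKernel a r with hκ
  have hκ0 : κ ≠ 0 := (integral_fracKernel_neg ha ha1).ne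
  have hΓ : 0 < Real.Gamma a := Real.Gamma_pos_of_pos ha
  have hw1 : Tendsto (fun ε => ∫ t in Ioi ε, t ^ (-a - 1) • (S t u - u)) (𝓝[>] 0)
      (𝓝 (Real.Gamma (-a) • w)) := by
    have := hw.const_smul (Real.Gamma (-a))
    simpa [smul_smul, mul_inv_cancel₀ (gamma_neg_ne_zero ha ha1)] using this
  have hw2 := hw1.sub (hS.tendsto_integral_one_sub_exp ha ha1 u)
  set g := Real.Gamma (-a) • w - ∫ t in Ioi 0, (t ^ (-a - 1) * (1 - Real.exp (-t))) • S t u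
  have hw3 : Tendsto (fun ε => ∫ t in Ioi ε, t ^ (-a - 1) • (Real.exp (-t) • S t u - u))
      (𝓝[>] 0) (𝓝 g) := by
    refine hw2.congr' ?_
    filter_upwards [self_mem_nhdsWithin] with ε hε
    rw [hS.integral_increment_eq ha ha1 hε, add_sub_cancel_right]
  have hw4 : Tendsto (fun ε => ∫ t in Ioi ε, t ^ (-a - 1) •
      (Real.exp (-t) • S t (hS.bessel ha u) - hS.bessel ha u)) (𝓝[>] 0)
      (𝓝 (hS.bessel ha g)) := by
    refine (((hS.bessel ha).continuous.tendsto g).comp hw3).congr' ?_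
    filter_upwards [self_mem_nhdsWithin] with ε hε
    exact hS.bessel_integral_damped ha hε u
  have h5 := tendsto_nhds_unique (hS.tendsto_integral_damped_bessel ha ha1 u) hw4
  refine ⟨(Real.Gamma a * κ⁻¹) • g, ?_⟩
  rw [hS.besselPotential_eq ha, map_smul, ← h5, smul_smul, smul_smul]
  rw [show (Real.Gamma a)⁻¹ * (Real.Gamma a * κ⁻¹) * κ = 1 by field_simp, one_smul]

omit hS in
lemma setIntegral_Ioc_gamma_le {a t : ℝ} (ha : 0 < a) (ht : 0 < t) :
    ∫ s in Ioc 0 t, s ^ (a - 1) * Real.exp (-s) ≤ a⁻¹ * t ^ a := by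
  have h1 : IntegrableOn (fun s : ℝ => s ^ (a - 1)) (Ioc 0 t) :=
    (intervalIntegrable_iff_integrableOn_Ioc_of_le ht.le).1
      (intervalIntegral.intervalIntegrable_rpow' (by linarith))
  calc ∫ s in Ioc 0 t, s ^ (a - 1) * Real.exp (-s) ≤ ∫ s in Ioc 0 t, s ^ (a - 1) := by
        refine setIntegral_mono_on ((integrableOn_rpow_mul_exp ha).mono_set Ioc_subset_Ioi_self)
          h1 measurableSet_Ioc fun s hs => ?_
        have hs0 : 0 < s := hs.1
        exact mul_le_of_le_one_right (by positivity) (by simpa using hs0.le)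
    _ = a⁻¹ * t ^ a := by
        rw [← intervalIntegral.integral_of_le ht.le, integral_rpow (Or.inl (by linarith))]
        simp [Real.zero_rpow ha.ne', div_eq_inv_mul]

/-- Bessel potentials of order `a` are Hölder continuous of order `a` along the semigroup. The
density `g(s) = s^(a-1) e^(-s)` decreases, so that the `L₁`-distance from `g` to its translate by
`t` is twice the mass of `(0, t]`. -/
lemma norm_increment_bessel_le {a t : ℝ} (ha : 0 < a) (ha1 : a < 1) (ht : 0 < t) (h : E) :
    ‖S t (hS.bessel ha h) - hS.bessel ha h‖ ≤ 2 * a⁻¹ * t ^ a * ‖h‖ := by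
  set g : ℝ → ℝ := fun s => s ^ (a - 1) * Real.exp (-s) with hg
  have hgi : IntegrableOn g (Ioi 0) := integrableOn_rpow_mul_exp ha
  have hgt : IntegrableOn g (Ioi t) := hgi.mono_set (Ioi_subset_Ioi ht.le)
  have hgc : IntegrableOn g (Ioc 0 t) := hgi.mono_set Ioc_subset_Ioi_self
  have hgs : IntegrableOn (fun r => g (r - t)) (Ioi t) := by
    rw [← integrableOn_shift]; simpa using hgi
  have hanti : ∀ r ∈ Ioi t, g r ≤ g (r - t) := by
    intro r hr
    have hr : t < r := hr
    have h0 : 0 < r - t := sub_pos.2 hr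
    have h1 : r ^ (a - 1) ≤ (r - t) ^ (a - 1) :=
      Real.rpow_le_rpow_of_nonpos h0 (by linarith) (by linarith)
    simp only [hg]
    gcongr
    linarith
  have hsub : Ioi t ⊆ Ioi (0 : ℝ) := Ioi_subset_Ioi ht.le
  have e1 : S t (hS.bessel ha h) = ∫ r in Ioi t, g (r - t) • S r h := by
    rw [bessel_apply, ← (S t).integral_comp_comm
      (hS.integrableOn_smul measurableSet_Ioi Subset.rfl (integrableOn_rpow_mul_exp ha) h),
      ← setIntegral_shift (fun r => g (r - t) • S r h) t]
    refine setIntegral_congr_fun measurableSet_Ioi fun s hs => ?_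
    simp only [map_smul, add_sub_cancel_right, hg]
    rw [hS.add s t hs ht]
  have e2 : hS.bessel ha h = (∫ r in Ioc 0 t, g r • S r h) + ∫ r in Ioi t, g r • S r h := by
    rw [bessel_apply, ← Ioc_union_Ioi_eq_Ioi ht.le, setIntegral_union
      (Ioc_disjoint_Ioi le_rfl) measurableSet_Ioi
      (hS.integrableOn_smul measurableSet_Ioc Ioc_subset_Ioi_self hgc h)
      (hS.integrableOn_smul measurableSet_Ioi hsub hgt h)]
  have e3 : S t (hS.bessel ha h) - hS.bessel ha h =
      (∫ r in Ioi t, (g (r - t) - g r) • S r h) - ∫ r in Ioc 0 t, g r • S r h := by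
    simp_rw [sub_smul]
    rw [integral_sub (hS.integrableOn_smul measurableSet_Ioi hsub hgs h)
      (hS.integrableOn_smul measurableSet_Ioi hsub hgt h), e1]
    conv_lhs => rw [e2]
    abel
  have m1 : ∫ r in Ioi t, ‖g (r - t) - g r‖ = ∫ r in Ioc 0 t, g r := by
    have : ∫ r in Ioi t, ‖g (r - t) - g r‖ = ∫ r in Ioi t, (g (r - t) - g r) :=
      setIntegral_congr_fun measurableSet_Ioi fun r hr =>
        Real.norm_of_nonneg (sub_nonneg.2 (hanti r hr))
    rw [this, integral_sub hgs hgt, ← setIntegral_shift]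
    simp only [add_sub_cancel_right]
    rw [← Ioc_union_Ioi_eq_Ioi ht.le, setIntegral_union
      (Ioc_disjoint_Ioi le_rfl) measurableSet_Ioi hgc hgt, add_sub_cancel_right]
  have m2 : ∫ r in Ioc 0 t, ‖g r‖ = ∫ r in Ioc 0 t, g r :=
    setIntegral_congr_fun measurableSet_Ioc fun r hr => by
      have : 0 < r := hr.1
      exact Real.norm_of_nonneg (by positivity)
  rw [e3]
  refine (_root_.norm_sub_le _ _).trans ?_
  have b1 := hS.norm_integral_smul_le measurableSet_Ioi hsub (hgs.sub hgt) h
  have b2 := hS.norm_integral_smul_le measurableSet_Ioc Ioc_subset_Ioi_self hgc h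
  simp only [Pi.sub_apply] at b1
  rw [m1] at b1
  rw [m2] at b2
  have b3 : ∫ r in Ioc 0 t, g r ≤ a⁻¹ * t ^ a := setIntegral_Ioc_gamma_le ha ht
  have b4 := mul_le_mul_of_nonneg_right b3 (norm_nonneg h)
  linarith

omit [CompleteSpace E] in
/-- Hölder continuity along the semigroup of an order greater than `a` gives membership in the
domain of `A ^ a`. -/
lemma mem_fracDomain_of_increment_le {a γ M : ℝ} {u : E} (ha : 0 < a) (hγ : a < γ)
    (hu : ∀ t, 0 < t → t ≤ 1 → ‖S t u - u‖ ≤ M * t ^ γ) :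
    u ∈ fracDomain S a ∧
      ‖fracPow S a u‖ ≤ |Real.Gamma (-a)|⁻¹ * (M / (γ - a) + 2 * ‖u‖ / a) := by
  have hI1 : IntegrableOn (fun t : ℝ => M * t ^ (γ - a - 1)) (Ioc 0 1) :=
    ((intervalIntegrable_iff_integrableOn_Ioc_of_le zero_le_one).1
        (intervalIntegral.intervalIntegrable_rpow' (by linarith))).const_mul _
  have hI2 : IntegrableOn (fun t : ℝ => 2 * ‖u‖ * t ^ (-a - 1)) (Ioi 1) :=
    (integrableOn_Ioi_rpow_of_lt (by linarith) zero_lt_one).const_mul _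
  have hb1 : ∀ t ∈ Ioc (0 : ℝ) 1, ‖t ^ (-a - 1) • (S t u - u)‖ ≤ M * t ^ (γ - a - 1) := by
    intro t ht
    have ht0 : 0 < t := ht.1
    rw [norm_smul, Real.norm_of_nonneg (by positivity)]
    calc t ^ (-a - 1) * ‖S t u - u‖ ≤ t ^ (-a - 1) * (M * t ^ γ) := by
          gcongr; exact hu t ht0 ht.2
      _ = M * (t ^ (-a - 1) * t ^ γ) := by ring
      _ = _ := by rw [← Real.rpow_add ht0]; ring_nf
  have hb2 : ∀ t ∈ Ioi (1 : ℝ), ‖t ^ (-a - 1) • (S t u - u)‖ ≤ 2 * ‖u‖ * t ^ (-a - 1) := by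
    intro t ht
    have ht0 : 0 < t := zero_lt_one.trans ht
    rw [norm_smul, Real.norm_of_nonneg (by positivity), mul_comm]
    gcongr
    refine (_root_.norm_sub_le _ _).trans ?_
    linarith [hS.norm_le t ht0 u]
  have hm : ∀ s : Set ℝ, MeasurableSet s → s ⊆ Ioi 0 →
      AEStronglyMeasurable (fun t => t ^ (-a - 1) • (S t u - u)) (volume.restrict s) :=
    fun s hs h => (by fun_prop : Measurable fun t : ℝ => t ^ (-a - 1)).aestronglyMeasurable.smul
      ((hS.aestronglyMeasurable u hs h).sub aestronglyMeasurable_const)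
  have hi1 : IntegrableOn (fun t => t ^ (-a - 1) • (S t u - u)) (Ioc 0 1) :=
    Integrable.mono' hI1 (hm _ measurableSet_Ioc Ioc_subset_Ioi_self)
      ((ae_restrict_iff' measurableSet_Ioc).2 (Eventually.of_forall hb1))
  have hi2 : IntegrableOn (fun t => t ^ (-a - 1) • (S t u - u)) (Ioi 1) :=
    Integrable.mono' hI2 (hm _ measurableSet_Ioi (Ioi_subset_Ioi zero_le_one))
      ((ae_restrict_iff' measurableSet_Ioi).2 (Eventually.of_forall hb2))
  have hi : IntegrableOn (fun t => t ^ (-a - 1) • (S t u - u)) (Ioi 0) := by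
    rw [← Ioc_union_Ioi_eq_Ioi (zero_le_one' ℝ)]; exact hi1.union hi2
  have hlim : HasFracPow S a u ((Real.Gamma (-a))⁻¹ •
      ∫ t in Ioi 0, t ^ (-a - 1) • (S t u - u)) :=
    (tendsto_setIntegral_Ioi_zero hi).const_smul _
  refine ⟨⟨_, hlim⟩, ?_⟩
  rw [hlim.fracPow_eq, norm_smul, norm_inv, Real.norm_eq_abs]
  gcongr
  rw [← Ioc_union_Ioi_eq_Ioi (zero_le_one' ℝ), setIntegral_union
      (Ioc_disjoint_Ioi le_rfl) measurableSet_Ioi hi1 hi2]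
  refine (norm_add_le _ _).trans (add_le_add ?_ ?_)
  · refine (norm_integral_le_of_norm_le hI1
      ((ae_restrict_iff' measurableSet_Ioc).2 (Eventually.of_forall hb1))).trans_eq ?_
    rw [integral_const_mul, ← intervalIntegral.integral_of_le zero_le_one,
      integral_rpow (Or.inl (by linarith)), sub_add_cancel,
      Real.zero_rpow (by linarith), Real.one_rpow, sub_zero, mul_one_div]
  · refine (norm_integral_le_of_norm_le hI2
      ((ae_restrict_iff' measurableSet_Ioi).2 (Eventually.of_forall hb2))).trans_eq ?_
    rw [integral_const_mul, integral_Ioi_rpow_of_lt (by linarith) one_pos, sub_add_cancel,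
      Real.one_rpow, neg_div_neg_eq, mul_one_div]

end IsContrSemigroup

end

/-! ### Kernels with sub-Markovian rows and columns -/

section

variable {X : Type*} [MeasurableSpace X] {μ : Measure X}

/-- The measure `q(x, ·) dμ`. -/
def rowMeasure (μ : Measure X) (q : X → X → ℝ) (x : X) : Measure X :=
  μ.withDensity fun y => ENNReal.ofReal (q x y)

/-- A jointly measurable kernel whose rows and columns have mass at most `1`. -/
structure IsDoublySubMarkov (μ : Measure X) (q : X → X → ℝ) : Prop where
  measurable : Measurable fun z : X × X => q z.1 z.2
  nonneg : ∀ x y, 0 ≤ q x y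
  row : ∀ᵐ x ∂μ, rowMeasure μ q x univ ≤ 1
  col : ∀ᵐ y ∂μ, ∫⁻ x, ENNReal.ofReal (q x y) ∂μ ≤ 1

lemma rowMeasure_absolutelyContinuous (q : X → X → ℝ) (x : X) : rowMeasure μ q x ≪ μ :=
  withDensity_absolutelyContinuous _ _

namespace IsDoublySubMarkov

variable {q : X → X → ℝ} (hq : IsDoublySubMarkov μ q)
include hq

lemma measurable_row (x : X) : Measurable (q x) := hq.measurable.comp measurable_prodMk_left

lemma lintegral_row (x : X) (f : X → ℝ≥0∞) (hf : Measurable f) :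
    ∫⁻ y, f y ∂(rowMeasure μ q x) = ∫⁻ y, ENNReal.ofReal (q x y) * f y ∂μ :=
  lintegral_withDensity_eq_lintegral_mul _ (hq.measurable_row x).ennreal_ofReal hf

lemma integral_row (x : X) (f : X → ℝ) :
    ∫ y, f y ∂(rowMeasure μ q x) = ∫ y, q x y * f y ∂μ := by
  rw [rowMeasure, integral_withDensity_eq_integral_toReal_smul
    (hq.measurable_row x).ennreal_ofReal (Eventually.of_forall fun _ => ENNReal.ofReal_lt_top)]
  simp [ENNReal.toReal_ofReal (hq.nonneg x _)]

variable [SigmaFinite μ]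

lemma measurable_lintegral_row {f : X → ℝ≥0∞} (hf : Measurable f) :
    Measurable fun x => ∫⁻ y, f y ∂(rowMeasure μ q x) := by
  simp_rw [hq.lintegral_row _ f hf]
  refine Measurable.lintegral_prod_right
    (f := fun x y => ENNReal.ofReal (q x y) * f y) ?_
  exact hq.measurable.ennreal_ofReal.mul (hf.comp measurable_snd)

lemma stronglyMeasurable_integral_row {f : X → ℝ} (hf : AEStronglyMeasurable f μ) :
    StronglyMeasurable fun x => ∫ y, f y ∂(rowMeasure μ q x) := by
  have h1 : ∀ x, ∫ y, f y ∂(rowMeasure μ q x) = ∫ y, q x y * hf.mk f y ∂μ := by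
    intro x
    rw [← hq.integral_row]
    exact integral_congr_ae ((rowMeasure_absolutelyContinuous q x).ae_eq hf.ae_eq_mk)
  simp_rw [h1]
  refine StronglyMeasurable.integral_prod_right (f := fun x y => q x y * hf.mk f y) ?_
  exact hq.measurable.stronglyMeasurable.mul
    (hf.stronglyMeasurable_mk.comp_measurable measurable_snd)

/-- Contractivity on `L₁`, from the bound for columns. -/
lemma lintegral_lintegral_row_le {f : X → ℝ≥0∞} (hf : AEMeasurable f μ) :
    ∫⁻ x, ∫⁻ y, f y ∂(rowMeasure μ q x) ∂μ ≤ ∫⁻ y, f y ∂μ := by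
  have h1 : ∀ x, ∫⁻ y, f y ∂(rowMeasure μ q x) = ∫⁻ y, ENNReal.ofReal (q x y) * hf.mk f y ∂μ := by
    intro x
    rw [← hq.lintegral_row _ _ hf.measurable_mk]
    exact lintegral_congr_ae ((rowMeasure_absolutelyContinuous q x).ae_eq hf.ae_eq_mk)
  simp_rw [h1]
  rw [lintegral_lintegral_swap]
  · rw [lintegral_congr_ae hf.ae_eq_mk]
    refine lintegral_mono_ae ?_
    filter_upwards [hq.col] with y hy
    have hy' : Measurable fun x => q x y := hq.measurable.comp measurable_prodMk_right
    rw [lintegral_mul_const _ hy'.ennreal_ofReal]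
    exact mul_le_of_le_one_left' hy
  · exact (hq.measurable.ennreal_ofReal.mul (hf.measurable_mk.comp measurable_snd)).aemeasurable

lemma ae_memLp_row {p : ℝ≥0∞} (hp0 : p ≠ 0) (hp : p ≠ ∞) {f : X → ℝ} (hf : MemLp f p μ) :
    ∀ᵐ x ∂μ, MemLp f p (rowMeasure μ q x) := by
  have hm : AEMeasurable (fun y => ‖f y‖ₑ ^ p.toReal) μ := hf.1.enorm.pow_const _
  have h1 := lintegral_rpow_enorm_lt_top_of_eLpNorm_lt_top hp0 hp hf.2
  have h2 := (hq.lintegral_lintegral_row_le hm).trans_lt h1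
  have hmeas : AEMeasurable (fun x => ∫⁻ y, ‖f y‖ₑ ^ p.toReal ∂(rowMeasure μ q x)) μ := by
    refine ((hq.measurable_lintegral_row hm.measurable_mk).aemeasurable).congr ?_
    exact Eventually.of_forall fun x => lintegral_congr_ae
      ((rowMeasure_absolutelyContinuous q x).ae_eq hm.ae_eq_mk).symm
  filter_upwards [ae_lt_top' hmeas h2.ne] with x hx
  refine ⟨hf.1.mono_ac (rowMeasure_absolutelyContinuous q x), ?_⟩
  exact (eLpNorm_lt_top_iff_lintegral_rpow_enorm_lt_top hp0 hp).2 hx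

omit [SigmaFinite μ] in
/-- Jensen's inequality for rows. -/
lemma eLpNorm_row_mono {p r : ℝ≥0∞} (hpr : p ≤ r) {f : X → ℝ} (hf : AEStronglyMeasurable f μ) :
    ∀ᵐ x ∂μ, eLpNorm f p (rowMeasure μ q x) ≤ eLpNorm f r (rowMeasure μ q x) := by
  rcases eq_or_ne p 0 with rfl | hp0
  · simp
  filter_upwards [hq.row] with x hx
  refine (eLpNorm_le_eLpNorm_mul_rpow_measure_univ hpr
    (hf.mono_ac (rowMeasure_absolutelyContinuous q x))).trans ?_
  refine mul_le_of_le_one_right' (ENNReal.rpow_le_one hx ?_)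
  rcases eq_or_ne r ∞ with rfl | hr
  · simp
  · rw [sub_nonneg]
    have := ENNReal.toReal_mono hr hpr
    have hp : 0 < p.toReal := ENNReal.toReal_pos hp0 (ne_top_of_le_ne_top hr hpr)
    gcongr

/-- Contractivity of the kernel on `L_p`, in the stronger form in which the average `∫ f q(x, ·)` is
replaced by an `L_r`-norm, `r ≤ p`: Jensen's inequality for rows, then the bound for columns. -/
lemma eLpNorm_eLpNorm_row_le {p r : ℝ≥0∞} (hp0 : p ≠ 0) (hp : p ≠ ∞) (hr : r ≤ p) {f : X → ℝ}
    (hf : AEStronglyMeasurable f μ) :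
    eLpNorm (fun x => eLpNorm f r (rowMeasure μ q x)) p μ ≤ eLpNorm f p μ := by
  rw [eLpNorm_eq_lintegral_rpow_enorm_toReal hp0 hp, eLpNorm_eq_lintegral_rpow_enorm_toReal hp0 hp]
  have hpp : 0 < p.toReal := ENNReal.toReal_pos hp0 hp
  refine ENNReal.rpow_le_rpow ?_ (by positivity)
  refine le_trans (lintegral_mono_ae ?_)
    (hq.lintegral_lintegral_row_le (hf.enorm.pow_const p.toReal))
  filter_upwards [hq.eLpNorm_row_mono hr hf] with x hx
  rw [enorm_eq_self]
  calc _ ≤ eLpNorm f p (rowMeasure μ q x) ^ p.toReal := by gcongr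
    _ = _ := by
      rw [eLpNorm_eq_lintegral_rpow_enorm_toReal hp0 hp, ← ENNReal.rpow_mul,
        one_div, inv_mul_cancel₀ hpp.ne', ENNReal.rpow_one]

lemma eLpNorm_integral_row_le {p : ℝ≥0∞} (hp1 : 1 ≤ p) (hp : p ≠ ∞) {f : X → ℝ}
    (hf : AEStronglyMeasurable f μ) :
    eLpNorm (fun x => ∫ y, f y ∂(rowMeasure μ q x)) p μ ≤ eLpNorm f p μ := by
  refine le_trans ?_ (hq.eLpNorm_eLpNorm_row_le (zero_lt_one.trans_le hp1).ne' hp hp1 hf)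
  refine eLpNorm_mono_enorm fun x => ?_
  rw [enorm_eq_self, eLpNorm_one_eq_lintegral_enorm]
  exact enorm_integral_le_lintegral_enorm _

lemma memLp_integral_row {p : ℝ≥0∞} (hp1 : 1 ≤ p) (hp : p ≠ ∞) {f : X → ℝ}
    (hf : MemLp f p μ) : MemLp (fun x => ∫ y, f y ∂(rowMeasure μ q x)) p μ :=
  ⟨(hq.stronglyMeasurable_integral_row hf.1).aestronglyMeasurable,
    (hq.eLpNorm_integral_row_le hp1 hp hf.1).trans_lt hf.2⟩

lemma ae_integrable_row {p : ℝ≥0∞} (hp1 : 1 ≤ p) (hp : p ≠ ∞) {f : X → ℝ}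
    (hf : MemLp f p μ) : ∀ᵐ x ∂μ, Integrable f (rowMeasure μ q x) := by
  filter_upwards [hq.ae_memLp_row (zero_lt_one.trans_le hp1).ne' hp hf,
    hq.eLpNorm_row_mono hp1 hf.1] with x h1 h2
  exact memLp_one_iff_integrable.1 ⟨h1.1, h2.trans_lt h1.2⟩

/-- The integral operator of the kernel is a contraction of `L_p`. -/
lemma exists_lpOperator (p : ℝ≥0∞) [h1 : Fact (1 ≤ p)] (hp : p ≠ ∞) :
    ∃ S : Lp ℝ p μ →L[ℝ] Lp ℝ p μ, ∀ f : Lp ℝ p μ, ‖S f‖ ≤ ‖f‖ ∧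
      (S f : X → ℝ) =ᵐ[μ] fun x => ∫ y, f y ∂(rowMeasure μ q x) := by
  have hm := fun f : Lp ℝ p μ => hq.memLp_integral_row h1.out hp (Lp.memLp f)
  let L : Lp ℝ p μ →ₗ[ℝ] Lp ℝ p μ :=
    { toFun := fun f => (hm f).toLp _
      map_add' := fun f g => by
        rw [← MemLp.toLp_add, MemLp.toLp_eq_toLp_iff]
        filter_upwards [hq.ae_integrable_row h1.out hp (Lp.memLp f),
          hq.ae_integrable_row h1.out hp (Lp.memLp g)] with x hf hg
        rw [Pi.add_apply, ← integral_add hf hg]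
        exact integral_congr_ae ((rowMeasure_absolutelyContinuous q x).ae_eq (Lp.coeFn_add f g))
      map_smul' := fun c f => by
        rw [RingHom.id_apply, ← MemLp.toLp_const_smul, MemLp.toLp_eq_toLp_iff]
        refine Eventually.of_forall fun x => ?_
        rw [Pi.smul_apply, ← integral_smul]
        exact integral_congr_ae
          ((rowMeasure_absolutelyContinuous q x).ae_eq (Lp.coeFn_smul c f)) }
  have hL : ∀ f, ‖L f‖ ≤ ‖f‖ := by
    intro f
    rw [Lp.norm_def, Lp.norm_def]
    refine ENNReal.toReal_mono (Lp.eLpNorm_ne_top f) ?_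
    refine (eLpNorm_congr_ae (MemLp.coeFn_toLp (hm f))).trans_le ?_
    exact hq.eLpNorm_integral_row_le h1.out hp (Lp.memLp f).1
  refine ⟨L.mkContinuous 1 fun f => by simpa using hL f, fun f => ⟨hL f, ?_⟩⟩
  exact MemLp.coeFn_toLp (hm f)

end IsDoublySubMarkov

end

/-! ### Transition densities -/

section

variable {X : Type*} [MeasurableSpace X] {μ : Measure X}

lemma ae_indicatorConstLp_mem {s : Set X} (hs : MeasurableSet s) (hμ : μ s ≠ ∞) :
    ∀ᵐ x ∂μ, 0 ≤ indicatorConstLp 2 hs hμ (1 : ℝ) x ∧ indicatorConstLp 2 hs hμ (1 : ℝ) x ≤ 1 := by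
  filter_upwards [indicatorConstLp_coeFn (p := 2) (hs := hs) (hμs := hμ) (c := (1 : ℝ))] with x hx
  rw [hx]
  by_cases h : x ∈ s <;> simp [h]

/-- `∫_s q(x, y) μ(dy) = R 1_s (x)`. -/
lemma ae_rowMeasure_eq {R : Lp ℝ 2 μ →L[ℝ] Lp ℝ 2 μ} {q : X → X → ℝ}
    (hq0 : ∀ x y, 0 ≤ q x y)
    (hrepr : ∀ u : Lp ℝ 2 μ, ∀ᵐ x ∂μ,
      Integrable (fun y => q x y * u y) μ ∧ R u x = ∫ y, q x y * u y ∂μ) :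
    ∀ {s : Set X} (hs : MeasurableSet s) (hμ : μ s ≠ ∞), ∀ᵐ x ∂μ,
      rowMeasure μ q x s = ENNReal.ofReal (R (indicatorConstLp 2 hs hμ 1) x) := by
  intro s hs hμ
  filter_upwards [hrepr (indicatorConstLp 2 hs hμ 1)] with x hx
  have h1 : (fun y => q x y * indicatorConstLp 2 hs hμ (1 : ℝ) y) =ᵐ[μ] s.indicator (q x) := by
    filter_upwards [indicatorConstLp_coeFn (p := 2) (hs := hs) (hμs := hμ) (c := (1 : ℝ))] with y hy
    rw [hy]
    by_cases h : y ∈ s <;> simp [h]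
  rw [hx.2, integral_congr_ae h1, ofReal_integral_eq_lintegral_ofReal (hx.1.congr h1)
    (Eventually.of_forall fun y => indicator_nonneg (fun y _ => hq0 x y) y), rowMeasure,
    withDensity_apply _ hs, ← lintegral_indicator hs]
  congr 1
  ext y
  by_cases h : y ∈ s <;> simp [h]

/-- The transition densities of a symmetric Markovian semigroup are sub-Markovian in both
variables: in the first one because of the Markov property, in the second one because
`∫_F T 1_E = ∫_E T 1_F`. -/
lemma IsTransitionDensity.isDoublySubMarkov [SigmaFinite μ] {T : ℝ → (Lp ℝ 2 μ →L[ℝ] Lp ℝ 2 μ)}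
    {q : ℝ → X → X → ℝ} (hT : IsSymmMarkovSemigroup μ T) (hq : IsTransitionDensity T q) {t : ℝ}
    (ht : 0 < t) : IsDoublySubMarkov μ (q t) := by
  have hrow : ∀ {s : Set X} (hs : MeasurableSet s) (hμ : μ s ≠ ∞), ∀ᵐ x ∂μ,
      rowMeasure μ (q t) x s = ENNReal.ofReal (T t (indicatorConstLp 2 hs hμ 1) x) :=
    fun hs hμ => ae_rowMeasure_eq (hq.nonneg t ht) (hq.repr t ht) hs hμ
  have hE : ∀ n, μ (spanningSets μ n) ≠ ∞ := fun n => (measure_spanningSets_lt_top μ n).ne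
  have hmE := measurableSet_spanningSets μ
  have hmono := monotone_spanningSets μ
  have hmk : ∀ {s : Set X} (hs : MeasurableSet s) (hμ : μ s ≠ ∞), ∀ᵐ x ∂μ,
      0 ≤ T t (indicatorConstLp 2 hs hμ 1) x ∧ T t (indicatorConstLp 2 hs hμ 1) x ≤ 1 :=
    fun hs hμ => hT.markov t ht.le _ (ae_indicatorConstLp_mem hs hμ)
  refine ⟨hq.measurable t ht, hq.nonneg t ht, ?_, ?_⟩
  · have h1 : ∀ᵐ x ∂μ, ∀ n, rowMeasure μ (q t) x (spanningSets μ n) ≤ 1 := by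
      rw [ae_all_iff]
      intro n
      filter_upwards [hrow (hmE n) (hE n), hmk (hmE n) (hE n)] with x h1 h2
      rw [h1]
      exact ENNReal.ofReal_le_one.2 h2.2
    filter_upwards [h1] with x hx
    rw [← iUnion_spanningSets μ, hmono.measure_iUnion]
    exact iSup_le hx
  · have hmeas : Measurable fun z : X × X => ENNReal.ofReal (q t z.1 z.2) :=
      (hq.measurable t ht).ennreal_ofReal
    have h1 : ∀ᵐ y ∂μ, ∀ n, ∫⁻ x in spanningSets μ n, ENNReal.ofReal (q t x y) ∂μ ≤ 1 := by
      rw [ae_all_iff]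
      intro n
      set E := spanningSets μ n
      have hmE : MeasurableSet E := hmE n
      have hE : μ E ≠ ∞ := hE n
      refine ae_le_of_forall_setLIntegral_le_of_sigmaFinite
        (Measurable.lintegral_prod_left' hmeas) fun F hF hμF => ?_
      have hsymm : ∫ x in E, T t (indicatorConstLp 2 hF hμF.ne 1) x ∂μ =
          ∫ x in F, T t (indicatorConstLp 2 hmE hE 1) x ∂μ := by
        rw [← L2.inner_indicatorConstLp_one (𝕜 := ℝ) hmE hE,
          ← L2.inner_indicatorConstLp_one (𝕜 := ℝ) hF hμF.ne, ← hT.symm t ht.le, real_inner_comm]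
      have hint : IntegrableOn (T t (indicatorConstLp 2 hF hμF.ne 1)) E μ :=
        integrableOn_Lp_of_measure_ne_top _ fact_one_le_two_ennreal.elim hE
      rw [lintegral_lintegral_swap (f := fun y x => ENNReal.ofReal (q t x y))
        (hmeas.comp measurable_swap).aemeasurable]
      calc ∫⁻ x in E, ∫⁻ y in F, ENNReal.ofReal (q t x y) ∂μ ∂μ
          = ∫⁻ x in E, ENNReal.ofReal (T t (indicatorConstLp 2 hF hμF.ne 1) x) ∂μ := by
            refine lintegral_congr_ae (ae_restrict_of_ae ?_)
            filter_upwards [hrow hF hμF.ne] with x hx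
            rw [← hx, rowMeasure, withDensity_apply _ hF]
        _ = ENNReal.ofReal (∫ x in F, T t (indicatorConstLp 2 hmE hE 1) x ∂μ) := by
            rw [← hsymm, ofReal_integral_eq_lintegral_ofReal hint
              (ae_restrict_of_ae ((hmk hF hμF.ne).mono fun x hx => hx.1))]
        _ ≤ ENNReal.ofReal (∫ x in F, 1 ∂μ) := by
            refine ENNReal.ofReal_le_ofReal (integral_mono_of_nonneg ?_ ?_ ?_)
            · exact ae_restrict_of_ae ((hmk hmE hE).mono fun x hx => hx.1)
            · exact integrableOn_const hμF.ne
            · exact ae_restrict_of_ae ((hmk hmE hE).mono fun x hx => hx.2)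
        _ = ∫⁻ _ in F, 1 ∂μ := by
            simp [Measure.real, ENNReal.ofReal_toReal hμF.ne]
    filter_upwards [h1] with y hy
    rw [← setLIntegral_univ, ← iUnion_spanningSets μ,
      setLIntegral_iUnion_of_directed _ hmono.directed_le]
    exact iSup_le hy

end

/-! ### The semigroup on `L_p` -/

section

variable {X : Type*} [MeasurableSpace X] {μ : Measure X}

/-- Lyapunov's inequality between `L₁` and `L₂`. -/
lemma eLpNorm_le_eLpNorm_one_mul_eLpNorm_two {P : ℝ} (h1 : 1 ≤ P) (h2 : P ≤ 2) {g : X → ℝ}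
    (hg : AEStronglyMeasurable g μ) :
    eLpNorm g (ENNReal.ofReal P) μ ≤
      eLpNorm g 1 μ ^ ((2 - P) / P) * eLpNorm g 2 μ ^ (2 * (P - 1) / P) := by
  have hP : 0 < P := by linarith
  have hp0 : ENNReal.ofReal P ≠ 0 := by simpa using hP
  rw [eLpNorm_eq_lintegral_rpow_enorm_toReal hp0 ENNReal.ofReal_ne_top,
    eLpNorm_eq_lintegral_rpow_enorm_toReal two_ne_zero ENNReal.ofNat_ne_top,
    eLpNorm_one_eq_lintegral_enorm, ENNReal.toReal_ofReal hP.le]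
  have h := ENNReal.lintegral_mul_norm_pow_le (μ := μ) hg.enorm (hg.enorm.pow_const (2 : ℝ))
    (p := 2 - P) (q := P - 1) (by linarith) (by linarith) (by ring)
  have e : ∀ x, ‖g x‖ₑ ^ P = ‖g x‖ₑ ^ (2 - P) * (‖g x‖ₑ ^ (2 : ℝ)) ^ (P - 1) := by
    intro x
    rw [← ENNReal.rpow_mul, ← ENNReal.rpow_add_of_nonneg _ _ (by linarith) (by linarith)]
    ring_nf
  simp_rw [← e] at h
  refine (ENNReal.rpow_le_rpow h (by positivity : 0 ≤ 1 / P)).trans_eq ?_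
  rw [ENNReal.mul_rpow_of_nonneg _ _ (by positivity), ← ENNReal.rpow_mul, ← ENNReal.rpow_mul,
    ← ENNReal.rpow_mul, ENNReal.toReal_ofNat]
  congr 2 <;> ring

/-- Uniqueness of the extension to `L_p`, by density of simple functions. -/
lemma IsLpExtension.eq {R : Lp ℝ 2 μ →L[ℝ] Lp ℝ 2 μ} {p : ℝ≥0∞} [Fact (1 ≤ p)] (hp : p ≠ ∞)
    {S S' : Lp ℝ p μ →L[ℝ] Lp ℝ p μ} (hS : IsLpExtension R p S) (hS' : IsLpExtension R p S') :
    S = S' := by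
  ext1 f
  induction f using Lp.induction hp with
  | indicatorConst c hs hμ =>
    rw [Lp.simpleFunc.coe_indicatorConst]
    exact Lp.ext ((hS _ (memLp_indicator_const 2 hs c (Or.inr hμ.ne)) _).trans
      (hS' _ (memLp_indicator_const 2 hs c (Or.inr hμ.ne)) _).symm)
  | add hf hg _ h1 h2 => rw [map_add, map_add, h1, h2]
  | isClosed => exact isClosed_eq S.continuous S'.continuous

section Kernel

variable [SigmaFinite μ] {T : ℝ → (Lp ℝ 2 μ →L[ℝ] Lp ℝ 2 μ)} {q : ℝ → X → X → ℝ}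
  (hT : IsSymmMarkovSemigroup μ T) (hq : IsTransitionDensity T q)
include hT hq

lemma coeFn_semigroup_eq {t : ℝ} (ht : 0 < t) (u : Lp ℝ 2 μ) :
    (T t u : X → ℝ) =ᵐ[μ] fun x => ∫ y, u y ∂(rowMeasure μ (q t) x) := by
  filter_upwards [hq.repr t ht u] with x hx
  rw [hx.2, (hq.isDoublySubMarkov hT ht).integral_row]

lemma eLpNorm_semigroup_le {p : ℝ≥0∞} (hp1 : 1 ≤ p) (hp : p ≠ ∞) {t : ℝ} (ht : 0 < t)
    (u : Lp ℝ 2 μ) : eLpNorm (T t u) p μ ≤ eLpNorm u p μ := by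
  rw [eLpNorm_congr_ae (coeFn_semigroup_eq hT hq ht u)]
  exact (hq.isDoublySubMarkov hT ht).eLpNorm_integral_row_le hp1 hp (Lp.memLp u).1

lemma isContrSemigroup_two : IsContrSemigroup T where
  norm_le t ht u := by
    rw [Lp.norm_def, Lp.norm_def]
    exact ENNReal.toReal_mono (Lp.eLpNorm_ne_top u)
      (eLpNorm_semigroup_le hT hq one_le_two ENNReal.ofNat_ne_top ht u)
  add s t hs ht u := by
    rw [add_comm, hT.add s t hs.le ht.le]; rfl
  tendsto := hT.strongly_continuous

/-- At positive times the semigroup on `L_p` is the integral operator of the transition density. -/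
lemma lpSemigroup_spec (p : ℝ≥0∞) [h1 : Fact (1 ≤ p)] (hp : p ≠ ∞) {t : ℝ} (ht : 0 < t) :
    IsLpExtension (T t) p (lpSemigroup T p t) ∧ ∀ f : Lp ℝ p μ,
      ‖lpSemigroup T p t f‖ ≤ ‖f‖ ∧
      (lpSemigroup T p t f : X → ℝ) =ᵐ[μ] fun x => ∫ y, f y ∂(rowMeasure μ (q t) x) := by
  obtain ⟨S, hS⟩ := (hq.isDoublySubMarkov hT ht).exists_lpOperator p hp
  have hext : IsLpExtension (T t) p S := by
    intro f h2 hp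
    refine (hS _).2.trans ((coeFn_semigroup_eq hT hq ht _).trans ?_).symm
    refine Eventually.of_forall fun x => integral_congr_ae ?_
    exact (rowMeasure_absolutelyContinuous _ x).ae_eq (h2.coeFn_toLp.trans hp.coeFn_toLp.symm)
  have hex : ∃ S : Lp ℝ p μ →L[ℝ] Lp ℝ p μ, IsLpExtension (T t) p S := ⟨S, hext⟩
  have hspec : IsLpExtension (T t) p (lpSemigroup T p t) := by
    rw [lpSemigroup, dif_pos hex]; exact hex.choose_spec
  refine ⟨hspec, ?_⟩
  rw [hspec.eq hp hext]
  exact hS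

/-- The semigroup on `L_p`, `1 < p ≤ 2`. Strong continuity is inherited from `L₂`: on
indicators `‖T t f - f‖₁` stays bounded, so that Lyapunov's inequality applies. -/
lemma isContrSemigroup_lp {P : ℝ} (hP1 : 1 < P) (hP2 : P ≤ 2) {p : ℝ≥0∞} [h1 : Fact (1 ≤ p)]
    (hpP : p = ENNReal.ofReal P) : IsContrSemigroup (lpSemigroup T p) := by
  have hp : p ≠ ∞ := hpP ▸ ENNReal.ofReal_ne_top
  have hspec := fun {t : ℝ} (ht : 0 < t) => lpSemigroup_spec hT hq p hp ht
  have hle : ∀ t, 0 < t → ∀ u, ‖lpSemigroup T p t u‖ ≤ ‖u‖ := fun t ht u => ((hspec ht).2 u).1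
  refine ⟨hle, ?_, ?_⟩
  · intro s t hs ht u
    induction u using Lp.induction hp with
    | indicatorConst c hA hμ =>
      rw [Lp.simpleFunc.coe_indicatorConst]
      rename_i A
      have h2 : MemLp (A.indicator fun _ => c) 2 μ := memLp_indicator_const 2 hA c (Or.inr hμ.ne)
      have hpm : MemLp (A.indicator fun _ => c) p μ := memLp_indicator_const p hA c (Or.inr hμ.ne)
      change lpSemigroup T p (s + t) (hpm.toLp _) =
        lpSemigroup T p t (lpSemigroup T p s (hpm.toLp _))
      have e1 := (hspec (add_pos hs ht)).1 _ h2 hpm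
      have e2 := (hspec hs).1 _ h2 hpm
      have hm : MemLp (T s (h2.toLp _)) p μ := (Lp.memLp _).ae_eq e2
      have e3 := (hspec ht).1 _ (Lp.memLp (T s (h2.toLp _))) hm
      have e4 : hm.toLp _ = lpSemigroup T p s (hpm.toLp _) :=
        Lp.ext (hm.coeFn_toLp.trans e2.symm)
      rw [e4] at e3
      refine Lp.ext (e1.trans (EventuallyEq.trans ?_ e3.symm))
      rw [Lp.toLp_coeFn, (isContrSemigroup_two hT hq).add s t hs ht]
    | add hf hg _ h1 h2 => simp only [map_add, h1, h2]
    | isClosed =>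
      exact isClosed_eq (lpSemigroup T p (s + t)).continuous
        ((lpSemigroup T p t).continuous.comp (lpSemigroup T p s).continuous)
  · intro u
    induction u using Lp.induction hp with
    | indicatorConst c hA hμ =>
      rw [Lp.simpleFunc.coe_indicatorConst]
      rename_i A
      have h2 : MemLp (A.indicator fun _ => c) 2 μ := memLp_indicator_const 2 hA c (Or.inr hμ.ne)
      have hpm : MemLp (A.indicator fun _ => c) p μ := memLp_indicator_const p hA c (Or.inr hμ.ne)
      have h1m : MemLp (A.indicator fun _ => c) 1 μ := memLp_indicator_const 1 hA c (Or.inr hμ.ne)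
      change Tendsto (fun t => lpSemigroup T p t (hpm.toLp _)) (𝓝[>] 0) (𝓝 (hpm.toLp _))
      set u := h2.toLp _ with hu
      have hu1 : eLpNorm u 1 μ ≠ ∞ := by
        rw [eLpNorm_congr_ae h2.coeFn_toLp]; exact h1m.2.ne
      rw [Lp.tendsto_Lp_iff_tendsto_eLpNorm']
      have hu2 := (Lp.tendsto_Lp_iff_tendsto_eLpNorm' _ _).1 (hT.strongly_continuous u)
      have hlim : Tendsto (fun t => (2 * eLpNorm u 1 μ) ^ ((2 - P) / P) *
          eLpNorm (⇑(T t u) - ⇑u) 2 μ ^ (2 * (P - 1) / P)) (𝓝[>] 0) (𝓝 0) := by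
        have hpos : 0 < 2 * (P - 1) / P := div_pos (by linarith) (by linarith)
        have h3 := (ENNReal.continuous_rpow_const (y := 2 * (P - 1) / P)).tendsto 0 |>.comp hu2
        rw [ENNReal.zero_rpow_of_pos hpos] at h3
        have h4 := ENNReal.Tendsto.const_mul (a := (2 * eLpNorm u 1 μ) ^ ((2 - P) / P)) h3
          (Or.inr (ENNReal.rpow_ne_top_of_nonneg (div_nonneg (by linarith) (by linarith))
            (ENNReal.mul_ne_top ENNReal.ofNat_ne_top hu1)))
        simpa using h4
      refine tendsto_of_tendsto_of_tendsto_of_le_of_le' tendsto_const_nhds hlim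
        (Eventually.of_forall fun _ => zero_le) ?_
      filter_upwards [self_mem_nhdsWithin] with t ht
      have ht : 0 < t := ht
      have e : (lpSemigroup T p t (hpm.toLp _) : X → ℝ) - (hpm.toLp _ : X → ℝ) =ᵐ[μ]
          ⇑(T t u) - ⇑u :=
        ((hspec ht).1 _ h2 hpm).sub (hpm.coeFn_toLp.trans h2.coeFn_toLp.symm)
      have hm : AEStronglyMeasurable (⇑(T t u) - ⇑u) μ := (Lp.memLp _).1.sub (Lp.memLp _).1
      rw [eLpNorm_congr_ae e, hpP]
      refine (eLpNorm_le_eLpNorm_one_mul_eLpNorm_two hP1.le hP2 hm).trans ?_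
      refine mul_le_mul' (ENNReal.rpow_le_rpow ?_ (div_nonneg (by linarith) (by linarith))) le_rfl
      refine (eLpNorm_sub_le (Lp.memLp _).1 (Lp.memLp _).1 le_rfl).trans ?_
      rw [two_mul]
      gcongr
      exact eLpNorm_semigroup_le hT hq le_rfl ENNReal.one_ne_top ht u
    | add hf hg _ h1 h2 => simpa only [map_add] using h1.add h2
    | isClosed =>
      refine isClosed_of_closure_subset fun f hf => ?_
      rw [mem_ofPred_eq, Metric.tendsto_nhds]
      intro ε hε
      obtain ⟨g, hg, hfg⟩ := Metric.mem_closure_iff.1 hf (ε / 3) (by positivity)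
      filter_upwards [self_mem_nhdsWithin, Metric.tendsto_nhds.1 hg (ε / 3) (by positivity)]
        with t ht hgt
      have h3 := hle t ht (f - g)
      rw [map_sub, ← dist_eq_norm, ← dist_eq_norm] at h3
      have h4 := dist_triangle4 (lpSemigroup T p t f) (lpSemigroup T p t g) g f
      rw [dist_comm g f] at h4
      linarith

end Kernel

end

/-! ### Energy and Sobolev estimates -/

/-- In a symmetric contraction semigroup the energy `E t = ⟪u - T t u, u⟫` satisfies
`E t = E (2 t) / 2 + ‖u - T t u‖² / 2`. Iterating this, Hölder continuity of order `a < 1/2` along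
the semigroup gives `E t = O(t ^ (2 a))`. -/
lemma inner_sub_semigroup_le {H : Type*} [NormedAddCommGroup H] [InnerProductSpace ℝ H]
    {T : ℝ → (H →L[ℝ] H)} (hT : IsContrSemigroup T)
    (hsymm : ∀ t : ℝ, 0 < t → ∀ u v : H, inner ℝ (T t u) v = inner ℝ u (T t v))
    {a K : ℝ} (ha1 : 2 * a < 1) {u : H}
    (hu : ∀ t, 0 < t → ‖T t u - u‖ ≤ K * t ^ a) {t : ℝ} (ht : 0 < t) :
    inner ℝ (u - T t u) u ≤ K ^ 2 * t ^ (2 * a) / (2 - 2 ^ (2 * a)) := by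
  have hD : (2 : ℝ) ^ (2 * a) < 2 := by
    have := Real.rpow_lt_rpow_of_exponent_lt (one_lt_two (α := ℝ)) ha1
    rwa [Real.rpow_one] at this
  have hD' : 0 < 2 - (2 : ℝ) ^ (2 * a) := by linarith
  have hstep : ∀ t, 0 < t → inner ℝ (u - T t u) u ≤
      inner ℝ (u - T (2 * t) u) u / 2 + K ^ 2 * t ^ (2 * a) / 2 := by
    intro t ht
    have h1 : ‖T t u - u‖ ^ 2 ≤ K ^ 2 * t ^ (2 * a) := by
      calc ‖T t u - u‖ ^ 2 ≤ (K * t ^ a) ^ 2 := by gcongr; exact hu t ht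
        _ = K ^ 2 * t ^ (2 * a) := by
          rw [mul_pow, ← Real.rpow_natCast (t ^ a), ← Real.rpow_mul ht.le]
          push_cast; ring_nf
    rw [two_mul, hT.add t t ht ht]
    rw [@norm_sub_sq ℝ] at h1
    simp only [RCLike.re_to_real] at h1
    rw [inner_sub_left, inner_sub_left, hsymm t ht (T t u) u, real_inner_self_eq_norm_sq,
      real_inner_self_eq_norm_sq]
    linarith
  have hind : ∀ n : ℕ, ∀ t, 0 < t → inner ℝ (u - T t u) u ≤
      2 * ‖u‖ ^ 2 * (1 / 2) ^ n + K ^ 2 * t ^ (2 * a) / (2 - 2 ^ (2 * a)) := by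
    intro n
    induction n with
    | zero =>
      intro t ht
      have h1 : inner ℝ (u - T t u) u ≤ ‖u - T t u‖ * ‖u‖ := real_inner_le_norm _ _
      have h2 : ‖u - T t u‖ ≤ ‖u‖ + ‖u‖ :=
        (_root_.norm_sub_le _ _).trans (by gcongr; exact hT.norm_le t ht u)
      have h3 : 0 ≤ K ^ 2 * t ^ (2 * a) / (2 - 2 ^ (2 * a)) := by positivity
      nlinarith [norm_nonneg u]
    | succ n ih =>
      intro t ht
      have h1 := hstep t ht
      have h2 := ih (2 * t) (by positivity)
      have h3 : K ^ 2 * (2 * t) ^ (2 * a) / (2 - 2 ^ (2 * a)) / 2 + K ^ 2 * t ^ (2 * a) / 2 =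
          K ^ 2 * t ^ (2 * a) / (2 - 2 ^ (2 * a)) := by
        rw [Real.mul_rpow zero_le_two ht.le]
        field_simp
        ring
      rw [pow_succ (1 / 2 : ℝ)]
      linarith
  refine ge_of_tendsto' (x := atTop) ?_ fun n : ℕ => hind n t ht
  have h := (tendsto_pow_atTop_nhds_zero_of_lt_one (r := (1 / 2 : ℝ)) (by norm_num)
    (by norm_num)).const_mul (2 * ‖u‖ ^ 2)
  simpa using h.add_const (K ^ 2 * t ^ (2 * a) / (2 - 2 ^ (2 * a)))

section

variable {X : Type*} [MeasurableSpace X] {μ : Measure X}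

/-- Interpolation between `L₂` and `L_∞`. -/
lemma eLpNorm_le_eLpNorm_two_mul_eLpNorm_top {r : ℝ} (hr : 2 ≤ r) {g : X → ℝ}
    (hg : AEStronglyMeasurable g μ) :
    eLpNorm g (ENNReal.ofReal r) μ ≤ eLpNorm g 2 μ ^ (2 / r) * eLpNorm g ∞ μ ^ (1 - 2 / r) := by
  have hr0 : 0 < r := by linarith
  have hp0 : ENNReal.ofReal r ≠ 0 := by simpa using hr0
  rw [eLpNorm_eq_lintegral_rpow_enorm_toReal hp0 ENNReal.ofReal_ne_top,
    eLpNorm_eq_lintegral_rpow_enorm_toReal two_ne_zero ENNReal.ofNat_ne_top,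
    ENNReal.toReal_ofReal hr0.le, ENNReal.toReal_ofNat]
  have h : ∫⁻ x, ‖g x‖ₑ ^ r ∂μ ≤ (∫⁻ x, ‖g x‖ₑ ^ (2 : ℝ) ∂μ) * eLpNorm g ∞ μ ^ (r - 2) := by
    rw [← lintegral_mul_const'' _ (hg.enorm.pow_const _)]
    refine lintegral_mono_ae ?_
    rw [eLpNorm_exponent_top]
    filter_upwards [enorm_ae_le_eLpNormEssSup g μ] with x hx
    calc ‖g x‖ₑ ^ r = ‖g x‖ₑ ^ (2 : ℝ) * ‖g x‖ₑ ^ (r - 2) := by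
          rw [← ENNReal.rpow_add_of_nonneg _ _ (by norm_num) (by linarith)]; ring_nf
      _ ≤ _ := by gcongr
  refine (ENNReal.rpow_le_rpow h (by positivity : 0 ≤ 1 / r)).trans_eq ?_
  rw [ENNReal.mul_rpow_of_nonneg _ _ (by positivity), ← ENNReal.rpow_mul, ← ENNReal.rpow_mul]
  congr 2 <;> field_simp

/-- Balls of `L_r` are convex and closed in `L₂`. -/
lemma convex_isClosed_setOf_eLpNorm_le {r : ℝ≥0∞} (hr : 1 ≤ r) (B : ℝ≥0∞) :
    Convex ℝ {f : Lp ℝ 2 μ | eLpNorm f r μ ≤ B} ∧ IsClosed {f : Lp ℝ 2 μ | eLpNorm f r μ ≤ B} := by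
  constructor
  · intro f hf g hg x y hx hy hxy
    have e : (x • f + y • g : Lp ℝ 2 μ) =ᵐ[μ] x • (f : X → ℝ) + y • (g : X → ℝ) := by
      refine (Lp.coeFn_add _ _).trans ?_
      exact (Lp.coeFn_smul x f).add (Lp.coeFn_smul y g)
    change eLpNorm _ r μ ≤ B
    rw [eLpNorm_congr_ae e]
    refine (eLpNorm_add_le ((Lp.memLp f).1.const_smul x) ((Lp.memLp g).1.const_smul y) hr).trans ?_
    rw [eLpNorm_const_smul, eLpNorm_const_smul]
    calc ‖x‖ₑ * eLpNorm f r μ + ‖y‖ₑ * eLpNorm g r μ ≤ ‖x‖ₑ * B + ‖y‖ₑ * B := by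
          gcongr; exacts [hf, hg]
      _ = B := by
          rw [← add_mul, Real.enorm_of_nonneg hx, Real.enorm_of_nonneg hy,
            ← ENNReal.ofReal_add hx hy, hxy, ENNReal.ofReal_one, one_mul]
  · refine isClosed_of_closure_subset fun f hf => ?_
    obtain ⟨g, hg, hlim⟩ := mem_closure_iff_seq_limit.1 hf
    obtain ⟨ns, -, hns⟩ := (tendstoInMeasure_of_tendsto_Lp hlim).exists_seq_tendsto_ae
    refine (Lp.eLpNorm_lim_le_liminf_eLpNorm (fun n => (Lp.memLp (g (ns n))).1) f hns).trans ?_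
    refine (liminf_le_liminf (v := fun _ => B)
      (Eventually.of_forall fun n => hg (ns n))).trans_eq ?_
    exact liminf_const B

/-- Minkowski's integral inequality, for an integral in `L₂` of functions with bounded
`L_r`-norms. -/
lemma eLpNorm_integral_smul_le {r : ℝ≥0∞} (hr : 1 ≤ r) {s : Set ℝ} (hs : MeasurableSet s)
    {m b : ℝ → ℝ} {F : ℝ → Lp ℝ 2 μ} {B : ℝ} (hm : ∀ t ∈ s, 0 < m t)
    (hb : ∀ t ∈ s, 0 < b t) (hmb : IntegrableOn (fun t => m t * b t) s)
    (hF : IntegrableOn (fun t => m t • F t) s)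
    (hle : ∀ t ∈ s, eLpNorm (F t) r μ ≤ ENNReal.ofReal (b t * B)) :
    eLpNorm (∫ t in s, m t • F t : Lp ℝ 2 μ) r μ ≤ ENNReal.ofReal ((∫ t in s, m t * b t) * B) := by
  set Z := ∫ t in s, m t * b t with hZ
  have hnn : 0 ≤ᵐ[volume.restrict s] fun t => m t * b t :=
    (ae_restrict_iff' hs).2 (Eventually.of_forall fun t ht => (mul_pos (hm t ht) (hb t ht)).le)
  rcases (integral_nonneg_of_ae hnn).eq_or_lt with h0 | hZ0
  · have hvol : volume s = 0 := by
      have h1 := (integral_eq_zero_iff_of_nonneg_ae hnn hmb).1 h0.symm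
      have h2 : ∀ᵐ t ∂(volume.restrict s), False := by
        filter_upwards [h1, ae_restrict_mem hs] with t h3 h4
        exact (mul_pos (hm t h4) (hb t h4)).ne' h3
      simpa using h2
    rw [Measure.restrict_eq_zero.2 hvol, integral_zero_measure,
      eLpNorm_congr_ae (Lp.coeFn_zero _ _ _)]
    simp
  obtain ⟨hconv, hclosed⟩ := convex_isClosed_setOf_eLpNorm_le (μ := μ) hr (ENNReal.ofReal B)
  -- With respect to the probability measure `Z⁻¹ m b dt`, the integral is `Z` times the mean of
  -- `b⁻¹ F`, whose values lie in the ball of radius `B`.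
  let ν : Measure ℝ := (volume.restrict s).withDensity fun t => ENNReal.ofReal (Z⁻¹ * (m t * b t))
  have hmeas : AEMeasurable (fun t => ENNReal.ofReal (Z⁻¹ * (m t * b t))) (volume.restrict s) :=
    (hmb.aestronglyMeasurable.aemeasurable.const_mul _).ennreal_ofReal
  have hnn' : ∀ t ∈ s, 0 ≤ Z⁻¹ * (m t * b t) := fun t ht =>
    mul_nonneg (inv_nonneg.2 hZ0.le) (mul_pos (hm t ht) (hb t ht)).le
  have hν : IsProbabilityMeasure ν := by
    refine ⟨?_⟩
    rw [withDensity_apply _ MeasurableSet.univ, Measure.restrict_univ,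
      ← ofReal_integral_eq_lintegral_ofReal (hmb.const_mul _)
      ((ae_restrict_iff' hs).2 (Eventually.of_forall hnn')), integral_const_mul,
      inv_mul_cancel₀ hZ0.ne', ENNReal.ofReal_one]
  have hνac : ν ≪ volume.restrict s := withDensity_absolutelyContinuous _ _
  have hlt : ∀ᵐ t ∂(volume.restrict s), ENNReal.ofReal (Z⁻¹ * (m t * b t)) < ∞ :=
    Eventually.of_forall fun _ => ENNReal.ofReal_lt_top
  have key : ∀ t ∈ s, (ENNReal.ofReal (Z⁻¹ * (m t * b t))).toReal • (b t)⁻¹ • F t =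
      Z⁻¹ • (m t • F t) := by
    intro t ht
    rw [ENNReal.toReal_ofReal (hnn' t ht), smul_smul, smul_smul]
    have := (hb t ht).ne'
    congr 1
    field_simp
  have hint : Integrable (fun t => (b t)⁻¹ • F t) ν := by
    rw [integrable_withDensity_iff_integrable_smul₀' hmeas hlt]
    refine (Integrable.smul Z⁻¹ hF).congr ?_
    exact (ae_restrict_iff' hs).2 (Eventually.of_forall fun t ht => (key t ht).symm)
  have hmem := hconv.integral_mem hclosed (f := fun t => (b t)⁻¹ • F t) (μ := ν) (by
    refine hνac.ae_le ((ae_restrict_iff' hs).2 (Eventually.of_forall fun t ht => ?_))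
    change eLpNorm _ r μ ≤ _
    rw [eLpNorm_congr_ae (Lp.coeFn_smul _ _), eLpNorm_const_smul,
      Real.enorm_of_nonneg (inv_nonneg.2 (hb t ht).le)]
    refine (mul_le_mul_right (hle t ht) _).trans_eq ?_
    rw [← ENNReal.ofReal_mul (inv_nonneg.2 (hb t ht).le), inv_mul_cancel_left₀ (hb t ht).ne'])
    hint
  have e : ∫ t in s, m t • F t = Z • ∫ t, (b t)⁻¹ • F t ∂ν := by
    rw [integral_withDensity_eq_integral_toReal_smul₀ hmeas hlt,
      setIntegral_congr_fun hs key, integral_smul, smul_inv_smul₀ hZ0.ne']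
  rw [e, eLpNorm_congr_ae (Lp.coeFn_smul _ _), eLpNorm_const_smul,
    Real.enorm_of_nonneg hZ0.le, ENNReal.ofReal_mul hZ0.le]
  gcongr
  exact hmem

/-- The subcritical Sobolev embedding: an ultracontractive semigroup with spectral dimension `dS`
has Bessel potentials of order `2 a` in `L_r` whenever `1/r > 1/2 - 2 a / dS`. -/
lemma exists_eLpNorm_bessel_le {T : ℝ → (Lp ℝ 2 μ →L[ℝ] Lp ℝ 2 μ)} (hT : IsContrSemigroup T)
    {dS : ℝ} (hultra : IsUltracontractive T dS) {a r : ℝ} (ha : 0 < a) (hr : 2 ≤ r)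
    (har : dS / 4 * (1 - 2 / r) < a) :
    ∃ C : ℝ, 0 < C ∧ ∀ h : Lp ℝ 2 μ,
      eLpNorm (hT.bessel ha h) (ENNReal.ofReal r) μ ≤ ENNReal.ofReal (C * ‖h‖) := by
  obtain ⟨c, ω, hc, hω, hω1, hTc⟩ := hultra
  have hr0 : 0 < r := by linarith
  set l := 1 - 2 / r with hl
  have hl0 : 0 ≤ l := by
    rw [hl, sub_nonneg, div_le_one hr0]; exact hr
  have hl1 : l < 1 := by
    have : 0 < 2 / r := by positivity
    linarith
  set b : ℝ → ℝ := fun t => (c * t ^ (-dS / 4) * Real.exp (ω * t)) ^ l with hbdef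
  have hb : ∀ t ∈ Ioi (0 : ℝ), 0 < b t := fun t ht => by
    have : 0 < t := ht
    positivity
  have hm : ∀ t ∈ Ioi (0 : ℝ), 0 < t ^ (a - 1) * Real.exp (-t) := fun t ht => by
    have : 0 < t := ht
    positivity
  have hmb : IntegrableOn (fun t => t ^ (a - 1) * Real.exp (-t) * b t) (Ioi 0) := by
    have h1 : IntegrableOn (fun t : ℝ => c ^ l * (t ^ (a - 1 - dS / 4 * l) *
        Real.exp (-(1 - ω * l) * t ^ (1 : ℝ)))) (Ioi 0) :=
      (integrableOn_rpow_mul_exp_neg_mul_rpow (by linarith) one_pos (by nlinarith)).const_mul _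
    refine h1.congr_fun (fun t ht => ?_) measurableSet_Ioi
    have ht : 0 < t := ht
    simp only [hbdef]
    rw [Real.mul_rpow (by positivity) (by positivity), Real.mul_rpow hc.le (by positivity),
      ← Real.rpow_mul ht.le, ← Real.exp_mul, Real.rpow_one,
      show a - 1 - dS / 4 * l = (a - 1) + (-dS / 4 * l) by ring, Real.rpow_add ht,
      show -(1 - ω * l) * t = -t + ω * t * l by ring, Real.exp_add]
    ring
  have hle : ∀ h : Lp ℝ 2 μ, ∀ t ∈ Ioi (0 : ℝ),
      eLpNorm (T t h) (ENNReal.ofReal r) μ ≤ ENNReal.ofReal (b t * ‖h‖) := by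
    intro h t ht
    have ht : 0 < t := ht
    have hh : eLpNorm h 2 μ = ENNReal.ofReal ‖h‖ := by
      rw [Lp.norm_def, ENNReal.ofReal_toReal (Lp.eLpNorm_ne_top h)]
    have h2 : eLpNorm (T t h) 2 μ ≤ ENNReal.ofReal ‖h‖ := by
      rw [← ENNReal.ofReal_toReal (Lp.eLpNorm_ne_top (T t h)), ← Lp.norm_def]
      exact ENNReal.ofReal_le_ofReal (hT.norm_le t ht h)
    have h3 := hTc t ht h
    rw [hh, ← ENNReal.ofReal_mul (by positivity)] at h3
    refine (eLpNorm_le_eLpNorm_two_mul_eLpNorm_top hr (Lp.memLp _).1).trans ?_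
    calc _ ≤ ENNReal.ofReal ‖h‖ ^ (2 / r) *
          ENNReal.ofReal (c * t ^ (-dS / 4) * Real.exp (ω * t) * ‖h‖) ^ l := by gcongr
      _ = ENNReal.ofReal (‖h‖ ^ (2 / r) * (c * t ^ (-dS / 4) * Real.exp (ω * t) * ‖h‖) ^ l) := by
          rw [ENNReal.ofReal_rpow_of_nonneg (norm_nonneg h) (by positivity),
            ENNReal.ofReal_rpow_of_nonneg (by positivity) hl0, ENNReal.ofReal_mul (by positivity)]
      _ = _ := by
          congr 1
          rw [Real.mul_rpow (by positivity) (norm_nonneg h), mul_left_comm,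
            ← Real.rpow_add_of_nonneg (norm_nonneg h) (by positivity) hl0]
          rw [hl, add_sub_cancel, Real.rpow_one]
  refine ⟨∫ t in Ioi 0, t ^ (a - 1) * Real.exp (-t) * b t, ?_, fun h => ?_⟩
  · rw [setIntegral_pos_iff_support_of_nonneg_ae _ hmb]
    · rw [inter_eq_right.2]
      · simp
      · exact fun t ht => (mul_pos (hm t ht) (hb t ht)).ne'
    · exact (ae_restrict_iff' measurableSet_Ioi).2
        (Eventually.of_forall fun t ht => (mul_pos (hm t ht) (hb t ht)).le)
  · rw [hT.bessel_apply]
    refine eLpNorm_integral_smul_le (F := fun t => T t h)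
      (m := fun t => t ^ (a - 1) * Real.exp (-t)) ?_ measurableSet_Ioi hm hb hmb
      (hT.integrableOn_smul measurableSet_Ioi Subset.rfl (integrableOn_rpow_mul_exp ha) h) (hle h)
    rw [← ENNReal.ofReal_one]
    exact ENNReal.ofReal_le_ofReal (by linarith)

end

/-! ### The product estimate at a fixed time -/

section

variable {X : Type*} [MeasurableSpace X] {μ : Measure X}

/-- Hölder's inequality for `a · b^(1-θ) · b^θ` in `L_r · L_{2/(1-θ)} · L_{r/θ}`. -/
lemma eLpNorm_mul_le_interpolate {a b : X → ℝ≥0∞} (ha : AEMeasurable a μ) (hb : AEMeasurable b μ)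
    {P r θ : ℝ} (hP : 0 < P) (hr : 0 < r) (hθ0 : 0 ≤ θ) (hθ1 : θ ≤ 1)
    (h : 1 / P = (1 + θ) / r + (1 - θ) / 2) :
    eLpNorm (fun x => a x * b x) (ENNReal.ofReal P) μ ≤
      eLpNorm a (ENNReal.ofReal r) μ *
        (eLpNorm b 2 μ ^ (1 - θ) * eLpNorm b (ENNReal.ofReal r) μ ^ θ) := by
  have hP0 : ENNReal.ofReal P ≠ 0 := by simpa using hP
  have hr0 : ENNReal.ofReal r ≠ 0 := by simpa using hr
  have h1θ : 0 ≤ 1 - θ := by linarith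
  simp_rw [eLpNorm_eq_lintegral_rpow_enorm_toReal hP0 ENNReal.ofReal_ne_top,
    eLpNorm_eq_lintegral_rpow_enorm_toReal hr0 ENNReal.ofReal_ne_top,
    eLpNorm_eq_lintegral_rpow_enorm_toReal two_ne_zero ENNReal.ofNat_ne_top,
    ENNReal.toReal_ofReal hP.le, ENNReal.toReal_ofReal hr.le, ENNReal.toReal_ofNat, enorm_eq_self]
  have hsum : P / r + P * (1 - θ) / 2 + P * θ / r = 1 := by
    have : P * (1 / P) = 1 := by field_simp
    rw [h] at this
    linear_combination this
  have key := ENNReal.lintegral_prod_norm_pow_le (μ := μ) (Finset.univ : Finset (Fin 3))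
    (f := ![fun x => a x ^ r, fun x => b x ^ (2 : ℝ), fun x => b x ^ r])
    (by
      intro i _
      fin_cases i
      · exact ha.pow_const r
      · exact hb.pow_const _
      · exact hb.pow_const r)
    (p := ![P / r, P * (1 - θ) / 2, P * θ / r])
    (by simpa [Fin.sum_univ_three] using hsum)
    (by
      intro i _
      fin_cases i
      · change 0 ≤ P / r; positivity
      · change 0 ≤ P * (1 - θ) / 2; positivity
      · change 0 ≤ P * θ / r; positivity)
  simp only [Fin.prod_univ_three, Matrix.cons_val_zero, Matrix.cons_val_one, Matrix.cons_val] at key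
  have e : ∀ x, (a x * b x) ^ P =
      (a x ^ r) ^ (P / r) * (b x ^ (2 : ℝ)) ^ (P * (1 - θ) / 2) * (b x ^ r) ^ (P * θ / r) := by
    intro x
    rw [← ENNReal.rpow_mul, ← ENNReal.rpow_mul, ← ENNReal.rpow_mul, mul_assoc,
      ← ENNReal.rpow_add_of_nonneg _ _ (by positivity) (by positivity),
      ENNReal.mul_rpow_of_nonneg _ _ hP.le]
    congr 2 <;> field_simp
    ring
  simp_rw [← e] at key
  refine (ENNReal.rpow_le_rpow key (by positivity : 0 ≤ 1 / P)).trans_eq ?_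
  rw [ENNReal.mul_rpow_of_nonneg _ _ (by positivity),
    ENNReal.mul_rpow_of_nonneg _ _ (by positivity)]
  simp_rw [← ENNReal.rpow_mul]
  have x1 : P / r * (1 / P) = 1 / r := by field_simp
  have x2 : P * (1 - θ) / 2 * (1 / P) = 1 / 2 * (1 - θ) := by field_simp
  have x3 : P * θ / r * (1 / P) = 1 / r * θ := by field_simp
  rw [mul_assoc, x1, x2, x3]

/-- The square root of `∫ (u(y) - u(x))² q(x, y) μ(dy)`. -/
def rowVariation (μ : Measure X) (q : X → X → ℝ) (u : X → ℝ) (x : X) : ℝ≥0∞ :=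
  eLpNorm (fun y => u y - u x) 2 (rowMeasure μ q x)

namespace IsDoublySubMarkov

variable {q : X → X → ℝ} (hq : IsDoublySubMarkov μ q) [SigmaFinite μ]
include hq

lemma measurable_eLpNorm_row {u : X → ℝ} (hu : Measurable u) :
    Measurable fun x => eLpNorm u 2 (rowMeasure μ q x) := by
  simp_rw [eLpNorm_eq_lintegral_rpow_enorm_toReal two_ne_zero ENNReal.ofNat_ne_top]
  exact (hq.measurable_lintegral_row (hu.enorm.pow_const _)).pow_const _

lemma measurable_rowVariation {u : X → ℝ} (hu : Measurable u) :
    Measurable (rowVariation μ q u) := by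
  have h1 : ∀ x, Measurable fun y => ‖u y - u x‖ₑ ^ (2 : ℝ≥0∞).toReal := fun x =>
    (hu.sub_const _).enorm.pow_const _
  unfold rowVariation
  simp_rw [eLpNorm_eq_lintegral_rpow_enorm_toReal two_ne_zero ENNReal.ofNat_ne_top]
  simp_rw [fun x => hq.lintegral_row x _ (h1 x)]
  refine Measurable.pow_const (Measurable.lintegral_prod_right
    (f := fun x y => ENNReal.ofReal (q x y) * ‖u y - u x‖ₑ ^ (2 : ℝ≥0∞).toReal) ?_) _
  exact hq.measurable.ennreal_ofReal.mul
    (((hu.comp measurable_snd).sub (hu.comp measurable_fst)).enorm.pow_const _)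

omit [SigmaFinite μ] in
lemma rowVariation_le {u : X → ℝ} (hu : AEStronglyMeasurable u μ) :
    ∀ᵐ x ∂μ, rowVariation μ q u x ≤ eLpNorm u 2 (rowMeasure μ q x) + ‖u x‖ₑ := by
  filter_upwards [hq.row] with x hx
  refine (eLpNorm_sub_le (hu.mono_ac (rowMeasure_absolutelyContinuous q x))
    aestronglyMeasurable_const one_le_two).trans ?_
  gcongr
  rcases eq_or_ne (rowMeasure μ q x) 0 with h0 | h0
  · simp [h0]
  rw [eLpNorm_const _ two_ne_zero h0]
  exact mul_le_of_le_one_right' (ENNReal.rpow_le_one hx (by positivity))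

/-- The triangle inequality in each row, followed by contractivity on `L_r`. -/
lemma eLpNorm_rowVariation_le {u : X → ℝ} (hu : Measurable u) {r : ℝ≥0∞} (hr : 2 ≤ r)
    (hr' : r ≠ ∞) : eLpNorm (rowVariation μ q u) r μ ≤ 2 * eLpNorm u r μ := by
  have hum : AEStronglyMeasurable u μ := hu.aestronglyMeasurable
  have hr0 : r ≠ 0 := (two_pos.trans_le hr).ne'
  have h1 : 1 ≤ r.toReal := by
    rw [← ENNReal.toReal_one]
    exact ENNReal.toReal_mono hr' (one_le_two.trans hr)
  have h2 := hq.eLpNorm_eLpNorm_row_le hr0 hr' hr hum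
  rw [two_mul]
  refine le_trans ?_ (add_le_add_left h2 _)
  simp_rw [eLpNorm_eq_lintegral_rpow_enorm_toReal hr0 hr', enorm_eq_self]
  refine le_trans ?_ (ENNReal.lintegral_Lp_add_le (hq.measurable_eLpNorm_row hu).aemeasurable
    hu.enorm.aemeasurable h1)
  refine ENNReal.rpow_le_rpow (lintegral_mono_ae ?_) (by positivity)
  filter_upwards [hq.rowVariation_le hum] with x hx
  gcongr
  exact hx

/-- The pointwise product estimate: `u(y) v(y) - u(x) v(x) = (u(y) - u(x)) v(y) +
u(x) (v(y) - v(x))` is integrated over the row of `x`, where the mass missing in the row needs no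
separate treatment, and the Cauchy–Schwarz inequality is applied to the first term. -/
lemma enorm_integral_mul_sub_le (u v : Lp ℝ 2 μ) :
    ∀ᵐ x ∂μ, ‖∫ y, u y * v y ∂(rowMeasure μ q x) - u x * v x‖ₑ ≤
      eLpNorm v 2 (rowMeasure μ q x) * rowVariation μ q u x +
        ‖u x‖ₑ * ‖∫ y, v y ∂(rowMeasure μ q x) - v x‖ₑ := by
  filter_upwards [hq.ae_memLp_row two_ne_zero ENNReal.ofNat_ne_top (Lp.memLp u),
    hq.ae_memLp_row two_ne_zero ENNReal.ofNat_ne_top (Lp.memLp v), hq.row] with x hu hv hx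
  set ρ := rowMeasure μ q x
  have : IsFiniteMeasure ρ := ⟨hx.trans_lt ENNReal.one_lt_top⟩
  have huv : Integrable (fun y => u y * v y) ρ := hu.integrable_mul hv
  have hv1 : Integrable v ρ := hv.integrable one_le_two
  have hd : MemLp (fun y => u y - u x) 2 ρ := hu.sub (memLp_const _)
  have e : ∫ y, u y * v y ∂ρ - u x * v x =
      ∫ y, (u y - u x) * v y ∂ρ + u x * (∫ y, v y ∂ρ - v x) := by
    simp_rw [sub_mul]
    rw [integral_sub huv (hv1.const_mul _), integral_const_mul]
    ring
  rw [e]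
  refine (enorm_add_le _ _).trans (add_le_add ?_ ?_)
  · refine (enorm_integral_le_lintegral_enorm _).trans ?_
    have hCS : eLpNorm ((fun y => u y - u x) • (v : X → ℝ)) 1 ρ ≤
        eLpNorm (fun y => u y - u x) 2 ρ * eLpNorm (v : X → ℝ) 2 ρ :=
      eLpNorm_smul_le_mul_eLpNorm hv.1 hd.1
    rw [← eLpNorm_one_eq_lintegral_enorm, mul_comm]
    exact hCS
  · rw [enorm_mul]

/-- `∫∫ (u(y) - u(x))² q(x, y) μ(dy) μ(dx) ≤ 2 ⟪u - R u, u⟫`, where `R` is the integral operator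
of `q`. -/
lemma eLpNorm_rowVariation_two_le (u w : Lp ℝ 2 μ)
    (hw : (w : X → ℝ) =ᵐ[μ] fun x => ∫ y, u y ∂(rowMeasure μ q x)) :
    eLpNorm (rowVariation μ q u) 2 μ ≤ ENNReal.ofReal √(2 * inner ℝ (u - w) u) := by
  have hu2 : Integrable (fun x => u x ^ 2) μ := (Lp.memLp u).integrable_sq
  have hu2' : MemLp (fun x => u x ^ 2) 1 μ := memLp_one_iff_integrable.2 hu2
  have huw : Integrable (fun x => u x * w x) μ := (Lp.memLp u).integrable_mul (Lp.memLp w)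
  have hP : Integrable (fun x => ∫ y, u y ^ 2 ∂(rowMeasure μ q x)) μ :=
    memLp_one_iff_integrable.1 (hq.memLp_integral_row le_rfl ENNReal.one_ne_top hu2')
  have hPle : ∫ x, ∫ y, u y ^ 2 ∂(rowMeasure μ q x) ∂μ ≤ ∫ x, u x ^ 2 ∂μ := by
    have h := hq.eLpNorm_integral_row_le le_rfl ENNReal.one_ne_top hu2'.1
    rw [eLpNorm_one_eq_lintegral_enorm, eLpNorm_one_eq_lintegral_enorm] at h
    have h0 : ∀ x, 0 ≤ ∫ y, u y ^ 2 ∂(rowMeasure μ q x) :=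
      fun x => integral_nonneg fun y => sq_nonneg _
    rw [integral_eq_lintegral_of_nonneg_ae (Eventually.of_forall h0) hP.1,
      integral_eq_lintegral_of_nonneg_ae (Eventually.of_forall fun x => sq_nonneg _) hu2.1]
    simp_rw [← Real.enorm_of_nonneg (h0 _), ← Real.enorm_of_nonneg (sq_nonneg (u _))]
    exact ENNReal.toReal_mono hu2.2.ne h
  -- `H` is the square of the variation with the mass of the row replaced by its bound `1`.
  set H : X → ℝ := fun x => ∫ y, u y ^ 2 ∂(rowMeasure μ q x) - 2 * (u x * w x) + u x ^ 2 with hH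
  have hHi : Integrable H μ := (hP.sub (huw.const_mul 2)).add hu2
  have hpt : ∀ᵐ x ∂μ, rowVariation μ q u x ^ (2 : ℝ) ≤ ENNReal.ofReal (H x) ∧ 0 ≤ H x := by
    filter_upwards [hq.ae_memLp_row two_ne_zero ENNReal.ofNat_ne_top (Lp.memLp u), hq.row, hw]
      with x hu hx hwx
    set ρ := rowMeasure μ q x
    have : IsFiniteMeasure ρ := ⟨hx.trans_lt ENNReal.one_lt_top⟩
    have hd : MemLp (fun y => u y - u x) 2 ρ := hu.sub (memLp_const _)
    have e1 : rowVariation μ q u x ^ (2 : ℝ) = ENNReal.ofReal (∫ y, (u y - u x) ^ 2 ∂ρ) := by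
      rw [rowVariation, eLpNorm_eq_lintegral_rpow_enorm_toReal two_ne_zero ENNReal.ofNat_ne_top,
        ← ENNReal.rpow_mul, ENNReal.toReal_ofNat,
        ofReal_integral_eq_lintegral_ofReal hd.integrable_sq
          (Eventually.of_forall fun y => sq_nonneg _)]
      rw [show (1 / (2 : ℝ)) * 2 = 1 by norm_num, ENNReal.rpow_one]
      refine lintegral_congr fun y => ?_
      rw [← sq_abs, ENNReal.ofReal_pow (abs_nonneg _), ← Real.enorm_eq_ofReal_abs]
      norm_cast
    have hu1 : Integrable u ρ := hu.integrable one_le_two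
    have e2 : ∫ y, (u y - u x) ^ 2 ∂ρ =
        ∫ y, u y ^ 2 ∂ρ - 2 * (u x * w x) + u x ^ 2 * ρ.real univ := by
      have : ∀ y, (u y - u x) ^ 2 = u y ^ 2 - 2 * u x * u y + u x ^ 2 := fun y => by ring
      simp_rw [this]
      have i1 : Integrable (fun y => u y ^ 2 - 2 * u x * u y) ρ :=
        hu.integrable_sq.sub (hu1.const_mul _)
      rw [integral_add i1 (integrable_const _),
        integral_sub hu.integrable_sq (hu1.const_mul _), integral_const_mul, integral_const, hwx,
        smul_eq_mul]
      ring
    have e3 : ∫ y, (u y - u x) ^ 2 ∂ρ ≤ H x := by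
      rw [e2, hH]
      have : ρ.real univ ≤ 1 := by
        rw [Measure.real, ← ENNReal.toReal_one]
        exact ENNReal.toReal_mono ENNReal.one_ne_top hx
      have := mul_le_of_le_one_right (sq_nonneg (u x)) this
      linarith
    refine ⟨?_, (integral_nonneg fun y => sq_nonneg _).trans e3⟩
    rw [e1]
    exact ENNReal.ofReal_le_ofReal e3
  have hHint : ∫ x, H x ∂μ ≤ 2 * inner ℝ (u - w) u := by
    have i1 : Integrable (fun x => ∫ y, u y ^ 2 ∂(rowMeasure μ q x) - 2 * (u x * w x)) μ :=
      hP.sub (huw.const_mul 2)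
    have e : ∫ x, H x ∂μ = ∫ x, ∫ y, u y ^ 2 ∂(rowMeasure μ q x) ∂μ -
        2 * ∫ x, u x * w x ∂μ + ∫ x, u x ^ 2 ∂μ := by
      rw [hH, integral_add i1 hu2, integral_sub hP (huw.const_mul 2), integral_const_mul]
    have i2 : inner ℝ u u = ∫ x, u x ^ 2 ∂μ := by
      rw [L2.inner_def]
      exact integral_congr_ae (Eventually.of_forall fun x => by simp [sq])
    have i3 : inner ℝ w u = ∫ x, u x * w x ∂μ := by
      rw [L2.inner_def]
      exact integral_congr_ae (Eventually.of_forall fun x => by simp)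
    rw [e, inner_sub_left, i2, i3]
    linarith
  rw [eLpNorm_eq_lintegral_rpow_enorm_toReal two_ne_zero ENNReal.ofNat_ne_top, Real.sqrt_eq_rpow,
    ENNReal.toReal_ofNat]
  have hH0 : 0 ≤ ∫ x, H x ∂μ := integral_nonneg_of_ae (hpt.mono fun x hx => hx.2)
  rw [← ENNReal.ofReal_rpow_of_nonneg (hH0.trans hHint) (by norm_num)]
  refine ENNReal.rpow_le_rpow ?_ (by norm_num)
  calc ∫⁻ x, ‖rowVariation μ q u x‖ₑ ^ (2 : ℝ) ∂μ ≤ ∫⁻ x, ENNReal.ofReal (H x) ∂μ :=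
        lintegral_mono_ae (hpt.mono fun x hx => by simpa using hx.1)
    _ = ENNReal.ofReal (∫ x, H x ∂μ) :=
        (ofReal_integral_eq_lintegral_ofReal hHi (hpt.mono fun x hx => hx.2)).symm
    _ ≤ _ := ENNReal.ofReal_le_ofReal hHint

/-- The product estimate in `L_P`. -/
lemma eLpNorm_integral_mul_sub_le (u v w : Lp ℝ 2 μ)
    (hw : (w : X → ℝ) =ᵐ[μ] fun x => ∫ y, v y ∂(rowMeasure μ q x))
    {P r θ : ℝ} (hP : 1 ≤ P) (hr : 2 ≤ r) (hθ0 : 0 ≤ θ) (hθ1 : θ ≤ 1)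
    (h : 1 / P = (1 + θ) / r + (1 - θ) / 2) :
    eLpNorm (fun x => ∫ y, u y * v y ∂(rowMeasure μ q x) - u x * v x) (ENNReal.ofReal P) μ ≤
      eLpNorm v (ENNReal.ofReal r) μ * (eLpNorm (rowVariation μ q u) 2 μ ^ (1 - θ) *
        eLpNorm (rowVariation μ q u) (ENNReal.ofReal r) μ ^ θ) +
      eLpNorm u (ENNReal.ofReal r) μ * (eLpNorm (w - v : Lp ℝ 2 μ) 2 μ ^ (1 - θ) *
        eLpNorm (w - v : Lp ℝ 2 μ) (ENNReal.ofReal r) μ ^ θ) := by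
  have hP0 : 0 < P := by linarith
  have hr0 : 0 < r := by linarith
  have hPne : ENNReal.ofReal P ≠ 0 := by simpa using hP0
  have hrne : ENNReal.ofReal r ≠ 0 := by simpa using hr0
  have h2r : 2 ≤ ENNReal.ofReal r := by
    rw [← ENNReal.ofReal_ofNat]; exact ENNReal.ofReal_le_ofReal hr
  have hum : Measurable u := (Lp.stronglyMeasurable u).measurable
  have hvm : Measurable v := (Lp.stronglyMeasurable v).measurable
  have hdm : Measurable (w - v : Lp ℝ 2 μ) := (Lp.stronglyMeasurable _).measurable
  have hm1 := (hq.measurable_eLpNorm_row hvm).aemeasurable (μ := μ)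
  have hm2 := (hq.measurable_rowVariation hum).aemeasurable (μ := μ)
  have b1 := eLpNorm_mul_le_interpolate hm1 hm2 hP0 hr0 hθ0 hθ1 h
  have b2 := eLpNorm_mul_le_interpolate hum.enorm.aemeasurable (hdm.enorm.aemeasurable (μ := μ))
    hP0 hr0 hθ0 hθ1 h
  simp only [eLpNorm_enorm] at b2
  refine le_trans ?_ (add_le_add (b1.trans (mul_le_mul' (hq.eLpNorm_eLpNorm_row_le hrne
    ENNReal.ofReal_ne_top h2r hvm.aestronglyMeasurable) le_rfl)) b2)
  simp_rw [eLpNorm_eq_lintegral_rpow_enorm_toReal hPne ENNReal.ofReal_ne_top,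
    ENNReal.toReal_ofReal hP0.le, enorm_eq_self]
  refine le_trans ?_ (ENNReal.lintegral_Lp_add_le (hm1.mul hm2)
    (hum.enorm.mul hdm.enorm).aemeasurable hP)
  refine ENNReal.rpow_le_rpow (lintegral_mono_ae ?_) (by positivity)
  filter_upwards [hq.enorm_integral_mul_sub_le u v, hw, Lp.coeFn_sub w v] with x h1 h2 h3
  refine ENNReal.rpow_le_rpow (h1.trans_eq ?_) hP0.le
  rw [Pi.add_apply, h3, Pi.sub_apply, h2]

end IsDoublySubMarkov

end

/-! ### Products of Bessel potentials -/

section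

variable {X : Type*} [MeasurableSpace X] {μ : Measure X}

lemma eLpNorm_two_eq_ofReal_norm (f : Lp ℝ 2 μ) : eLpNorm f 2 μ = ENNReal.ofReal ‖f‖ := by
  rw [Lp.norm_def, ENNReal.ofReal_toReal (Lp.eLpNorm_ne_top f)]

/-- Bookkeeping for Hölder's inequality: a bound that is linear in the norms `N`, `N'` and of order
`s^(1-θ)` results when the middle factor is of order `s`. -/
lemma mul_rpow_mul_rpow_le_ofReal {x y z : ℝ≥0∞} {A B C N N' s θ : ℝ} (hA : 0 ≤ A) (hB : 0 ≤ B)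
    (hC : 0 ≤ C) (hN : 0 ≤ N) (hN' : 0 ≤ N') (hs : 0 ≤ s) (hθ0 : 0 ≤ θ) (hθ1 : θ ≤ 1)
    (hx : x ≤ ENNReal.ofReal (A * N')) (hy : y ≤ ENNReal.ofReal (B * N * s))
    (hz : z ≤ ENNReal.ofReal (C * N)) :
    x * (y ^ (1 - θ) * z ^ θ) ≤
      ENNReal.ofReal (A * B ^ (1 - θ) * C ^ θ * (N * N') * s ^ (1 - θ)) := by
  have h1 : 0 ≤ 1 - θ := by linarith
  calc x * (y ^ (1 - θ) * z ^ θ) ≤ ENNReal.ofReal (A * N') *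
        (ENNReal.ofReal (B * N * s) ^ (1 - θ) * ENNReal.ofReal (C * N) ^ θ) := by gcongr
    _ = ENNReal.ofReal (A * N' * ((B * N * s) ^ (1 - θ) * (C * N) ^ θ)) := by
        rw [ENNReal.ofReal_rpow_of_nonneg (by positivity) h1,
          ENNReal.ofReal_rpow_of_nonneg (by positivity) hθ0, ← ENNReal.ofReal_mul (by positivity),
          ← ENNReal.ofReal_mul (by positivity)]
    _ = _ := by
        congr 1
        have e : N ^ (1 - θ) * N ^ θ = N := by
          rw [← Real.rpow_add_of_nonneg hN h1 hθ0, sub_add_cancel, Real.rpow_one]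
        rw [Real.mul_rpow (by positivity) hs, Real.mul_rpow hB hN, Real.mul_rpow hC hN]
        calc _ = A * B ^ (1 - θ) * C ^ θ * ((N ^ (1 - θ) * N ^ θ) * N') * s ^ (1 - θ) := by ring
          _ = _ := by rw [e]

variable [SigmaFinite μ] {T : ℝ → (Lp ℝ 2 μ →L[ℝ] Lp ℝ 2 μ)} {q : ℝ → X → X → ℝ}

/-- Products of Bessel potentials are Hölder continuous along the semigroup: the `L₂`-norms of
`T t v - v` and of the variation of `u` are `O(t^a)`, their `L_r`-norms are bounded, and the
interpolation parameter `θ` measures the loss in the order. -/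
lemma exists_eLpNorm_product_increment_le (hT : IsSymmMarkovSemigroup μ T)
    (hq : IsTransitionDensity T q) (hS : IsContrSemigroup T) {a C P r θ : ℝ} (ha : 0 < a)
    (ha1 : 2 * a < 1) (hC : 0 < C)
    (hsob : ∀ h : Lp ℝ 2 μ,
      eLpNorm (hS.bessel ha h) (ENNReal.ofReal r) μ ≤ ENNReal.ofReal (C * ‖h‖))
    (hP : 1 ≤ P) (hr : 2 ≤ r) (hθ0 : 0 ≤ θ) (hθ1 : θ ≤ 1)
    (h : 1 / P = (1 + θ) / r + (1 - θ) / 2) :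
    ∃ M : ℝ, 0 < M ∧ ∀ f g : Lp ℝ 2 μ, ∀ t, 0 < t →
      eLpNorm (fun x => ∫ y, hS.bessel ha f y * hS.bessel ha g y ∂(rowMeasure μ (q t) x) -
        hS.bessel ha f x * hS.bessel ha g x) (ENNReal.ofReal P) μ ≤
      ENNReal.ofReal (M * (‖f‖ * ‖g‖) * t ^ (a * (1 - θ))) := by
  have hD : (2 : ℝ) ^ (2 * a) < 2 := by
    have := Real.rpow_lt_rpow_of_exponent_lt (one_lt_two (α := ℝ)) ha1
    rwa [Real.rpow_one] at this
  have hD' : 0 < 2 - (2 : ℝ) ^ (2 * a) := by linarith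
  set K : ℝ := 2 * a⁻¹ with hK
  have hK0 : 0 < K := by positivity
  set L : ℝ := √(2 / (2 - 2 ^ (2 * a))) * K with hL
  have hL0 : 0 < L := by positivity
  have hr1 : 1 ≤ ENNReal.ofReal r := by
    rw [← ENNReal.ofReal_one]; exact ENNReal.ofReal_le_ofReal (by linarith)
  have h2r : 2 ≤ ENNReal.ofReal r := by
    rw [← ENNReal.ofReal_ofNat]; exact ENNReal.ofReal_le_ofReal hr
  have hincr : ∀ f : Lp ℝ 2 μ, ∀ t, 0 < t →
      ‖T t (hS.bessel ha f) - hS.bessel ha f‖ ≤ K * ‖f‖ * t ^ a := by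
    intro f t ht
    have := hS.norm_increment_bessel_le ha (by linarith) ht f
    linarith
  refine ⟨C * L ^ (1 - θ) * (2 * C) ^ θ + C * K ^ (1 - θ) * (2 * C) ^ θ, by positivity, ?_⟩
  intro f g t ht
  have hk := hq.isDoublySubMarkov hT ht
  set u := hS.bessel ha f with hu
  set v := hS.bessel ha g with hv
  have hum : Measurable u := (Lp.stronglyMeasurable u).measurable
  have e1 : eLpNorm (rowVariation μ (q t) u) 2 μ ≤ ENNReal.ofReal (L * ‖f‖ * t ^ a) := by
    refine (hk.eLpNorm_rowVariation_two_le u (T t u) (coeFn_semigroup_eq hT hq ht u)).trans ?_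
    refine ENNReal.ofReal_le_ofReal (Real.sqrt_le_iff.2 ⟨by positivity, ?_⟩)
    have := inner_sub_semigroup_le hS (fun t ht => hT.symm t ht.le) ha1 (hincr f) ht
    refine (mul_le_mul_of_nonneg_left this zero_le_two).trans_eq ?_
    have hL2 : L ^ 2 = 2 / (2 - 2 ^ (2 * a)) * K ^ 2 := by
      rw [hL, mul_pow, Real.sq_sqrt (by positivity)]
    have hta2 : (t ^ a) ^ 2 = t ^ (2 * a) := by
      rw [← Real.rpow_natCast, ← Real.rpow_mul ht.le]
      push_cast
      rw [mul_comm a 2]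
    have hexp : (L * ‖f‖ * t ^ a) ^ 2 = L ^ 2 * ‖f‖ ^ 2 * (t ^ a) ^ 2 := by ring
    rw [hexp, hL2, hta2]
    ring
  have e2 : eLpNorm (rowVariation μ (q t) u) (ENNReal.ofReal r) μ ≤
      ENNReal.ofReal (2 * C * ‖f‖) := by
    refine (hk.eLpNorm_rowVariation_le hum h2r ENNReal.ofReal_ne_top).trans ?_
    rw [mul_assoc, ENNReal.ofReal_mul zero_le_two, ENNReal.ofReal_ofNat]
    gcongr
    exact hsob f
  have e3 : eLpNorm (T t v - v : Lp ℝ 2 μ) 2 μ ≤ ENNReal.ofReal (K * ‖g‖ * t ^ a) := by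
    rw [eLpNorm_two_eq_ofReal_norm]
    exact ENNReal.ofReal_le_ofReal (hincr g t ht)
  have e4 : eLpNorm (T t v - v : Lp ℝ 2 μ) (ENNReal.ofReal r) μ ≤
      ENNReal.ofReal (2 * C * ‖g‖) := by
    rw [eLpNorm_congr_ae (Lp.coeFn_sub _ _)]
    refine (eLpNorm_sub_le (Lp.memLp _).1 (Lp.memLp _).1 hr1).trans ?_
    rw [mul_assoc, ENNReal.ofReal_mul zero_le_two, ENNReal.ofReal_ofNat, two_mul]
    exact add_le_add ((eLpNorm_semigroup_le hT hq hr1 ENNReal.ofReal_ne_top ht v).trans (hsob g))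
      (hsob g)
  refine (hk.eLpNorm_integral_mul_sub_le u v (T t v) (coeFn_semigroup_eq hT hq ht v)
    hP hr hθ0 hθ1 h).trans ?_
  have hta : 0 ≤ t ^ a := by positivity
  refine (add_le_add
    (mul_rpow_mul_rpow_le_ofReal hC.le hL0.le (by positivity : 0 ≤ 2 * C) (norm_nonneg f)
      (norm_nonneg g) hta hθ0 hθ1 (hsob g) e1 e2)
    (mul_rpow_mul_rpow_le_ofReal hC.le hK0.le (by positivity : 0 ≤ 2 * C) (norm_nonneg g)
      (norm_nonneg f) hta hθ0 hθ1 (hsob f) e3 e4)).trans_eq ?_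
  rw [← ENNReal.ofReal_add (by positivity) (by positivity), ← Real.rpow_mul ht.le,
    mul_comm ‖g‖ ‖f‖]
  congr 1
  ring

/-- The product theorem for Bessel potentials, in terms of the norms of their preimages. -/
lemma exists_potentialNorm_product_le (hT : IsSymmMarkovSemigroup μ T)
    (hq : IsTransitionDensity T q) (hS : IsContrSemigroup T) {a b C P r θ : ℝ} (ha : 0 < a)
    (ha1 : 2 * a < 1) (hb : 0 < b) (hbγ : b < a * (1 - θ)) (hC : 0 < C)
    (hsob : ∀ h : Lp ℝ 2 μ,
      eLpNorm (hS.bessel ha h) (ENNReal.ofReal r) μ ≤ ENNReal.ofReal (C * ‖h‖))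
    (hP : 1 < P) (hP2 : P ≤ 2) (hr : 2 ≤ r) (hθ0 : 0 ≤ θ) (hθ1 : θ ≤ 1)
    (h : 1 / P = (1 + θ) / r + (1 - θ) / 2)
    {p : ℝ≥0∞} [Fact (1 ≤ p)] (hpP : p = ENNReal.ofReal P) :
    ∃ Q : ℝ, 0 < Q ∧ ∀ f g : Lp ℝ 2 μ,
      ∃ huv : MemLp (fun x => hS.bessel ha f x * hS.bessel ha g x) p μ,
        huv.toLp _ ∈ fracDomain (lpSemigroup T p) b ∧
        potentialNorm (lpSemigroup T p) (2 * b) (huv.toLp _) ≤ Q * (‖f‖ * ‖g‖) := by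
  obtain ⟨M, hM, hinc⟩ :=
    exists_eLpNorm_product_increment_le hT hq hS ha ha1 hC hsob hP.le hr hθ0 hθ1 h
  have hSp := isContrSemigroup_lp hT hq hP hP2 hpP
  have hpne : p ≠ ∞ := hpP ▸ ENNReal.ofReal_ne_top
  set B := ‖hS.bessel ha‖ with hB
  have hB0 : 0 ≤ B := norm_nonneg _
  set D := C * B ^ (1 - θ) * C ^ θ with hD
  have hD0 : 0 ≤ D := by positivity
  set G := |Real.Gamma (-b)|⁻¹ with hG
  have hG0 : 0 ≤ G := by positivity
  have hγ : 0 < a * (1 - θ) - b := by linarith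
  refine ⟨1 + (D + G * (M / (a * (1 - θ) - b) + 2 * D / b)), by positivity, fun f g => ?_⟩
  set u := hS.bessel ha f with hu
  set v := hS.bessel ha g with hv
  have hum : Measurable u := (Lp.stronglyMeasurable u).measurable
  have hvm : Measurable v := (Lp.stronglyMeasurable v).measurable
  have hle : eLpNorm (fun x => u x * v x) p μ ≤ ENNReal.ofReal (D * (‖f‖ * ‖g‖)) := by
    have b1 := eLpNorm_mul_le_interpolate (hum.enorm.aemeasurable (μ := μ))
      (hvm.enorm.aemeasurable (μ := μ)) (by linarith : 0 < P) (by linarith : 0 < r) hθ0 hθ1 h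
    simp only [eLpNorm_enorm] at b1
    have b2 : eLpNorm v 2 μ ≤ ENNReal.ofReal (B * ‖g‖ * 1) := by
      rw [eLpNorm_two_eq_ofReal_norm, mul_one]
      exact ENNReal.ofReal_le_ofReal ((hS.bessel ha).le_opNorm g)
    have b3 := mul_rpow_mul_rpow_le_ofReal hC.le hB0 hC.le (norm_nonneg g) (norm_nonneg f)
      zero_le_one hθ0 hθ1 (hsob f) b2 (hsob g)
    rw [Real.one_rpow, mul_one, mul_comm ‖g‖ ‖f‖] at b3
    refine le_trans ?_ (b1.trans b3)
    rw [hpP]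
    exact eLpNorm_mono_enorm fun x => by rw [enorm_mul, enorm_eq_self]
  have huv : MemLp (fun x => u x * v x) p μ :=
    ⟨(hum.mul hvm).aestronglyMeasurable, hle.trans_lt ENNReal.ofReal_lt_top⟩
  refine ⟨huv, ?_⟩
  set w := huv.toLp _ with hw
  have hwn : ‖w‖ ≤ D * (‖f‖ * ‖g‖) := by
    rw [hw, Lp.norm_toLp]
    exact ENNReal.toReal_le_of_le_ofReal (by positivity) hle
  have hwinc : ∀ t, 0 < t → t ≤ 1 →
      ‖lpSemigroup T p t w - w‖ ≤ M * (‖f‖ * ‖g‖) * t ^ (a * (1 - θ)) := by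
    intro t ht _
    rw [Lp.norm_def]
    refine ENNReal.toReal_le_of_le_ofReal (by positivity) ?_
    refine le_trans (le_of_eq ?_) (hinc f g t ht)
    rw [← hpP]
    refine eLpNorm_congr_ae ?_
    filter_upwards [Lp.coeFn_sub (lpSemigroup T p t w) w,
      ((lpSemigroup_spec hT hq p hpne ht).2 w).2, huv.coeFn_toLp] with x h1 h2 h3
    rw [h1, Pi.sub_apply, h2, h3]
    congr 1
    exact integral_congr_ae
      ((rowMeasure_absolutelyContinuous (q t) x).ae_eq huv.coeFn_toLp)
  obtain ⟨hdom, hnorm⟩ := hSp.mem_fracDomain_of_increment_le hb hbγ hwinc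
  refine ⟨hdom, ?_⟩
  rw [potentialNorm, mul_div_cancel_left₀ b two_ne_zero]
  calc ‖w‖ + ‖fracPow (lpSemigroup T p) b w‖
      ≤ D * (‖f‖ * ‖g‖) + G * (M * (‖f‖ * ‖g‖) / (a * (1 - θ) - b) +
          2 * (D * (‖f‖ * ‖g‖)) / b) := by
        refine add_le_add hwn (hnorm.trans ?_)
        gcongr
    _ = (D + G * (M / (a * (1 - θ) - b) + 2 * D / b)) * (‖f‖ * ‖g‖) := by ring
    _ ≤ _ := mul_le_mul_of_nonneg_right (by linarith) (by positivity)

end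

end

theorem mainTheorem7 {X : Type*} [MetricSpace X] [LocallyCompactSpace X]
    [TopologicalSpace.SeparableSpace X] [MeasurableSpace X] [BorelSpace X]
    (μ : Measure X) [μ.Regular]
    (T : ℝ → (Lp ℝ 2 μ →L[ℝ] Lp ℝ 2 μ)) (hT : IsSymmMarkovSemigroup μ T)
    (dS β δ : ℝ) (hβ : 0 < β) (hβδ : β < δ) (hδ : δ < min (dS / 2) 1)
    (hultra : IsUltracontractive T dS) (hHK : HeatKernelAssumption T dS β)
    (p : ℝ≥0∞) [Fact (1 ≤ p)] (hp : p = ENNReal.ofReal (dS / (dS - δ))) :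
    ∃ c : ℝ, 0 < c ∧ ∀ u ∈ potentialSpace T δ, ∀ v ∈ potentialSpace T δ,
      ∃ huv : MemLp (fun x => u x * v x) p μ,
        huv.toLp (fun x => u x * v x) ∈ potentialSpace (lpSemigroup T p) β ∧
        huv.toLp (fun x => u x * v x) ∈ fracDomain (lpSemigroup T p) (β / 2) ∧
        potentialNorm (lpSemigroup T p) β (huv.toLp (fun x => u x * v x)) ≤
          c * potentialNorm T δ u * potentialNorm T δ v := by
  have : SecondCountableTopology X := UniformSpace.secondCountable_of_separable X
  have : SigmaFinite μ := inferInstance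
  obtain ⟨q, -, -, -, -, -, hq, -⟩ := hHK
  have hδ0 : 0 < δ := hβ.trans hβδ
  obtain ⟨hδS, hδ1⟩ := lt_min_iff.1 hδ
  have hdS : 0 < dS := by linarith
  have hdδ : 0 < dS - δ := by linarith
  have hS := isContrSemigroup_two hT hq
  have ha : 0 < δ / 2 := by positivity
  -- Half of the room between `β` and `δ` is spent on the interpolation, and `r` is then fixed by
  -- the exponent in Hölder's inequality; `θ > 0` puts `r` below the critical Sobolev exponent.
  set θ := (1 - β / δ) / 2 with hθ
  have hβδ' : β / δ < 1 := (div_lt_one hδ0).2 hβδ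
  have hβδ'' : 0 < β / δ := by positivity
  have hθ0 : 0 < θ := by rw [hθ]; linarith
  have hθ1 : θ ≤ 1 := by rw [hθ]; linarith
  have hx : δ / dS < 1 / 2 := by rw [div_lt_div_iff₀ hdS two_pos]; linarith
  have hx0 : 0 < δ / dS := by positivity
  set d := 1 / 2 - δ / dS + θ / 2 with hd
  have hd0 : 0 < d := by rw [hd]; linarith
  set r := (1 + θ) / d with hr
  have hr0 : 0 < r := by positivity
  have hr2 : 2 ≤ r := by
    rw [hr, le_div_iff₀ hd0, hd]; linarith
  have hrd : (1 + θ) / r = d := by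
    rw [hr]; field_simp
  have hP : 1 / (dS / (dS - δ)) = (1 + θ) / r + (1 - θ) / 2 := by
    rw [hrd, hd, one_div_div, sub_div, div_self hdS.ne']; ring
  have hP1 : 1 < dS / (dS - δ) := by rw [lt_div_iff₀ hdδ]; linarith
  have hP2 : dS / (dS - δ) ≤ 2 := by rw [div_le_iff₀ hdδ]; linarith
  have har : dS / 4 * (1 - 2 / r) < δ / 2 := by
    have h1 : (1 + θ) * (1 - 2 / r) = 2 * (δ / dS) := by
      have : (1 + θ) * (1 - 2 / r) = 1 + θ - 2 * ((1 + θ) / r) := by ring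
      rw [this, hrd, hd]; ring
    have h2 : 1 - 2 / r < 2 * (δ / dS) := by
      by_contra hcon
      push Not at hcon
      nlinarith
    calc dS / 4 * (1 - 2 / r) < dS / 4 * (2 * (δ / dS)) := by gcongr
      _ = δ / 2 := by field_simp; norm_num
  obtain ⟨C, hC, hsob⟩ := exists_eLpNorm_bessel_le hS hultra ha hr2 har
  have hb : 0 < β / 2 := by positivity
  have hbγ : β / 2 < δ / 2 * (1 - θ) := by
    have : δ / 2 * (1 - θ) = δ / 4 + β / 4 := by rw [hθ]; field_simp; ring
    linarith
  obtain ⟨Q, hQ, hprod⟩ := exists_potentialNorm_product_le hT hq hS ha (by linarith) hb hbγ hC hsob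
    hP1 hP2 hr2 hθ0.le hθ1 hP hp
  obtain ⟨N, hN, hnorm⟩ := hS.exists_norm_le_potentialNorm ha (by linarith)
  have hΓ : 0 < (Real.Gamma (δ / 2))⁻¹ := inv_pos.2 (Real.Gamma_pos_of_pos ha)
  have h2a : 2 * (δ / 2) = δ := by ring
  have h2b : 2 * (β / 2) = β := by ring
  have hrep : ∀ u ∈ potentialSpace T δ, ∃ f, hS.bessel ha f = u ∧
      ‖f‖ ≤ (Real.Gamma (δ / 2))⁻¹ * N * potentialNorm T δ u := by
    rintro _ ⟨h, rfl⟩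
    refine ⟨(Real.Gamma (δ / 2))⁻¹ • h, ?_, ?_⟩
    · rw [map_smul, ← hS.besselPotential_eq ha, h2a]
    · have := hnorm h
      rw [h2a] at this
      rw [norm_smul, Real.norm_of_nonneg hΓ.le, mul_assoc]
      gcongr
  refine ⟨Q * ((Real.Gamma (δ / 2))⁻¹ * N) ^ 2, by positivity, fun u hu v hv => ?_⟩
  obtain ⟨f, rfl, hf⟩ := hrep u hu
  obtain ⟨g, rfl, hg⟩ := hrep v hv
  obtain ⟨huv, hdom, hle⟩ := hprod f g
  have hSp := isContrSemigroup_lp hT hq hP1 hP2 hp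
  refine ⟨huv, ?_, hdom, ?_⟩
  · rw [← h2b]
    exact hSp.mem_potentialSpace_of_mem_fracDomain hb (by linarith) hdom
  · rw [h2b] at hle
    refine hle.trans ?_
    calc Q * (‖f‖ * ‖g‖) ≤ Q * (((Real.Gamma (δ / 2))⁻¹ * N * potentialNorm T δ (hS.bessel ha f)) *
          ((Real.Gamma (δ / 2))⁻¹ * N * potentialNorm T δ (hS.bessel ha g))) := by
          gcongr
          exact (norm_nonneg f).trans hf
      _ = _ := by ring
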